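/- **Theorem A.** *Conventions.* A cardinal is identified with its initial ordinal, and $\mu^+$ denotes the successor cardinal of $\mu$. For an ordinal $\sigma$ and a set $A$ of ordinals, $[A]^\sigma$ is the set of all $B\subseteq A$ of order type $\sigma$; $[\kappa]^2=\{(\alpha,\beta)\mid\alpha<\beta<\kappa\}$; and for a family $\mathcal A$ of sets of ordinals, $[\mathcal A]^2$ is the set of all $(a,b)\in\mathcal A\times\mathcal A$ with $a<b$, i.e. $\alpha<\beta$ for all $\alpha\in a$, $\beta\in b$. $E^{\mu^+}_\mu=\{\alpha<\mu^+\mid\mathrm{cf}(\alpha)=\mu\}$. For a regular uncountable cardinal $\kappa$ and a cardinal $\chi\le\kappa$: * A stationary set $S\subseteq\kappa$ is *nonreflecting* if there is no $\alpha<\kappa$ of uncountable cofinality such that $S\cap\alpha$ is stationary in $\alpha$. * $\clubsuit(S)$, for $S\subseteq\kappa$ stationary, asserts that there is a sequence $\langle A_\delta\mid\delta\in S\rangle$ such that $A_\delta$ is a cofinal subset of $\delta$ for every limit $\delta\in S$, and for every cofinal $B\subseteq\kappa$ the set $\{\delta\in S\mid A_\delta\subseteq B\}$ is stationary in $\kappa$.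 * The *stick principle at* $\mu^+$ asserts that there is a sequence $\langle X_\gamma\mid\gamma<\mu^+\rangle$ such that for every $X\in[\mu^+]^{\mu^+}$ there is $\gamma<\mu^+$ with $X_\gamma\in[X]^\mu$. * $\mathrm{pr}_1(\kappa,\kappa,\theta,\chi)$, for a cardinal $\theta\le\kappa$, asserts that there is $c:[\kappa]^2\to\theta$ such that for every $\sigma<\chi$, every pairwise disjoint $\mathcal A\subseteq[\kappa]^\sigma$ of size $\kappa$ and every $\tau<\theta$ there is $(a,b)\in[\mathcal A]^2$ with $c[a\times b]=\{\tau\}$. * $\mathrm{pl}_2(\kappa,\Gamma,\chi)$, for $\Gamma\subseteq\kappa$ stationary, asserts that there is $\mathbf t:[\kappa]^2\to[\kappa]^2$ such that (i) if $\mathbf t(\alpha,\beta)=(\alpha^*,\beta^*)$ then $\alpha^*\le\alpha<\beta^*\le\beta$; and (ii) for every $\sigma<\chi$ and every pairwise disjoint $\mathcal A\subseteq[\kappa]^\sigma$ of size $\kappa$ there is a club $D\subseteq\kappa$ such that for all $(\alpha^*,\beta^*)\in[\Gamma\cap D]^2$ there is $(a,b)\in[\mathcal A]^2$ with $\mathbf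 t[a\times b]=\{(\alpha^*,\beta^*)\}$. *Statement.* Let $\mu$ be an infinite regular cardinal. 1. Each of the following two hypotheses implies $\mathrm{pl}_2(\mu^+,E^{\mu^+}_\mu,\mu)$: (a) the stick principle at $\mu^+$; (b) $(\mu^+)^{\aleph_0}=\mu^+$, and $\clubsuit(S)$ holds for some nonreflecting stationary $S\subseteq\mu^+$. 2. Hypothesis (b) moreover implies $\mathrm{pl}_2(\mu^+,\mu^+,\mu)$. 3. If $2^\mu=\mu^+$, then $\mathrm{pr}_1(\mu^+,\mu^+,\mu^+,\mu)$ holds. -/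

import Mathlib

open Cardinal Ordinal Set

universe u

/-- `B` is a cofinal subset of the ordinal `o`. -/
def IsCofinalIn (o : Ordinal.{u}) (B : Set Ordinal.{u}) : Prop :=
  B ⊆ Iio o ∧ ∀ β < o, ∃ α ∈ B, β ≤ α

/-- `C` is a closed and unbounded subset of the ordinal `o` (used for `o` of uncountable
cofinality), through Mathlib's `IsClub` on the well-order of the ordinals below `o`. -/
def IsClubIn (o : Ordinal.{u}) (C : Set Ordinal.{u}) : Prop :=
  C ⊆ Iio o ∧ IsClub {x : Iio o | (x : Ordinal.{u}) ∈ C}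

/-- `S ∩ o` is a stationary subset of the ordinal `o` (used for `o` of uncountable cofinality). -/
def IsStationaryIn (o : Ordinal.{u}) (S : Set Ordinal.{u}) : Prop :=
  IsStationary {x : Iio o | (x : Ordinal.{u}) ∈ S}

/-- `S` is a nonreflecting stationary subset of the cardinal `κ`: it is stationary in `κ`, and
there is no `α < κ` of uncountable cofinality such that `S ∩ α` is stationary in `α`. -/
def IsNonreflectingStationary (κ : Cardinal.{u}) (S : Set Ordinal.{u}) : Prop :=
  S ⊆ Iio κ.ord ∧ IsStationaryIn κ.ord S ∧
    ¬ ∃ α < κ.ord, ℵ₀ < α.cof ∧ IsStationaryIn α S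

/-- The set `E^κ_χ` of the ordinals below `κ` of cofinality `χ`. -/
def cofSet (κ χ : Cardinal.{u}) : Set Ordinal.{u} :=
  {α | α < κ.ord ∧ α.cof = χ}

/-- The set of ordinals `a` has order type `σ`. -/
def HasOtp (a : Set Ordinal.{u}) (σ : Ordinal.{u}) : Prop :=
  typeLT a = Ordinal.lift.{u + 1} σ

/-- `[A]^σ`: the subsets of `A` of order type `σ`. -/
def subsetsOfType (A : Set Ordinal.{u}) (σ : Ordinal.{u}) : Set (Set Ordinal.{u}) :=
  {a | a ⊆ A ∧ HasOtp a σ}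

/-- `𝒜` is a pairwise disjoint subfamily of `[κ]^σ` of size `κ`. -/
def IsDisjointFamily (κ : Cardinal.{u}) (σ : Ordinal.{u}) (𝒜 : Set (Set Ordinal.{u})) : Prop :=
  𝒜 ⊆ subsetsOfType (Iio κ.ord) σ ∧
    (∀ a ∈ 𝒜, ∀ b ∈ 𝒜, a ≠ b → Disjoint a b) ∧
    #𝒜 = Cardinal.lift.{u + 1} κ

/-- `a < b` for sets of ordinals: every element of `a` is below every element of `b`. -/
def SetBelow (a b : Set Ordinal.{u}) : Prop :=
  ∀ α ∈ a, ∀ β ∈ b, α < β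

/-- The principle `pr₁(κ, κ, θ, χ)`. Only the values `c α β` for `α < β < κ` matter. -/
def PR1 (κ θ χ : Cardinal.{u}) : Prop :=
  ∃ c : Ordinal.{u} → Ordinal.{u} → Ordinal.{u},
    (∀ α β, α < β → β < κ.ord → c α β < θ.ord) ∧
    ∀ σ < χ.ord, ∀ 𝒜, IsDisjointFamily κ σ 𝒜 →
      ∀ τ < θ.ord, ∃ a ∈ 𝒜, ∃ b ∈ 𝒜, SetBelow a b ∧ image2 c a b = {τ}

/-- The principle `pl₂(κ, Γ, χ)` for a stationary subset `Γ` of `κ`. Only the values `t α β` for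
`α < β < κ` matter, and these are pairs `(α', β')` with `α' < β' < κ`. -/
def PL2 (κ : Cardinal.{u}) (Γ : Set Ordinal.{u}) (χ : Cardinal.{u}) : Prop :=
  Γ ⊆ Iio κ.ord ∧ IsStationaryIn κ.ord Γ ∧
    ∃ t : Ordinal.{u} → Ordinal.{u} → Ordinal.{u} × Ordinal.{u},
      (∀ α β, α < β → β < κ.ord → (t α β).1 ≤ α ∧ α < (t α β).2 ∧ (t α β).2 ≤ β) ∧
      ∀ σ < χ.ord, ∀ 𝒜, IsDisjointFamily κ σ 𝒜 →
        ∃ D, IsClubIn κ.ord D ∧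
          ∀ α' ∈ Γ ∩ D, ∀ β' ∈ Γ ∩ D, α' < β' →
            ∃ a ∈ 𝒜, ∃ b ∈ 𝒜, SetBelow a b ∧ image2 t a b = {(α', β')}

/-- The stick principle at `μ⁺`: there are sets `X γ`, `γ < μ⁺`, such that every subset of
`μ⁺` of size `μ⁺` includes some `X γ` of order type `μ`. -/
def Stick (μ : Cardinal.{u}) : Prop :=
  ∃ X : Ordinal.{u} → Set Ordinal.{u},
    ∀ Y ∈ subsetsOfType (Iio (Order.succ μ).ord) (Order.succ μ).ord,
      ∃ γ < (Order.succ μ).ord, X γ ∈ subsetsOfType Y μ.ord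

/-- The principle `♣(S)` for a subset `S` of `κ`: there is a sequence `⟨A δ | δ ∈ S⟩`, with `A δ`
cofinal in `δ` for every limit `δ ∈ S`, such that for every cofinal `B ⊆ κ` the set of all
`δ ∈ S` with `A δ ⊆ B` is stationary in `κ`. -/
def Clubsuit (κ : Cardinal.{u}) (S : Set Ordinal.{u}) : Prop :=
  ∃ A : Ordinal.{u} → Set Ordinal.{u},
    (∀ δ ∈ S, Order.IsSuccLimit δ → IsCofinalIn δ (A δ)) ∧
    ∀ B, IsCofinalIn κ.ord B → IsStationaryIn κ.ord {δ | δ ∈ S ∧ A δ ⊆ B}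

/-! ### Small sets -/

/-- The set `a` has fewer than `c` elements. -/
def SmallSet (c : Cardinal.{u}) {α : Type (u + 1)} (a : Set α) : Prop :=
  #a < Cardinal.lift.{u + 1} c

namespace SmallSet

variable {c : Cardinal.{u}} {α β : Type (u + 1)} {a b : Set α}

theorem mono (hb : SmallSet c b) (h : a ⊆ b) : SmallSet c a :=
  (mk_le_mk_of_subset h).trans_lt hb

theorem image (ha : SmallSet c a) (f : α → β) : SmallSet c (f '' a) :=
  mk_image_le.trans_lt ha

theorem biUnion (hc : c.IsRegular) {s : Set α} {t : α → Set β} (hs : SmallSet c s)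
    (ht : ∀ i ∈ s, SmallSet c (t i)) : SmallSet c (⋃ i ∈ s, t i) :=
  (card_biUnion_lt_iff_forall_of_isRegular (t := fun i _ ↦ t i) (IsRegular.lift hc) hs).2 ht

theorem of_finite (hc : ℵ₀ ≤ c) (ha : a.Finite) : SmallSet c a := by
  refine ha.lt_aleph0.trans_le ?_
  exact aleph0_le_lift.2 hc

theorem union (hc : ℵ₀ ≤ c) (ha : SmallSet c a) (hb : SmallSet c b) : SmallSet c (a ∪ b) := by
  refine (mk_union_le a b).trans_lt (add_lt_of_lt ?_ ha hb)
  exact aleph0_le_lift.2 hc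

theorem iUnion_countable (hc : c.IsRegular) (h0 : ℵ₀ < c) {ι : Type} [Countable ι]
    {t : ι → Set α} (ht : ∀ i, SmallSet c (t i)) : SmallSet c (⋃ i, t i) := by
  have : (⋃ i, t i) = ⋃ i ∈ (univ : Set (ULift.{u + 1} ι)), t i.down := by
    ext x
    simp only [mem_iUnion, mem_univ, exists_prop, true_and]
    exact ⟨fun ⟨i, hi⟩ ↦ ⟨⟨i⟩, hi⟩, fun ⟨i, hi⟩ ↦ ⟨i.down, hi⟩⟩
  rw [this]
  refine biUnion hc ?_ fun i _ ↦ ht _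
  rw [SmallSet, mk_univ]
  exact (mk_le_aleph0_iff.2 inferInstance).trans_lt (aleph0_lt_lift.2 h0)

theorem Iio_iff {δ : Ordinal.{u}} : SmallSet c (Iio δ) ↔ δ < c.ord := by
  rw [SmallSet, Cardinal.mk_Iio_ordinal, Cardinal.lift_lt, lt_ord]

theorem Iic (hc : ℵ₀ ≤ c) {δ : Ordinal.{u}} (h : δ < c.ord) : SmallSet c (Iic δ) := by
  rw [← Order.Iio_succ]
  exact Iio_iff.2 ((isSuccLimit_ord hc).succ_lt h)

theorem exists_lt {o : Ordinal.{u}} {a : Set Ordinal.{u}} (ha : SmallSet o.cof a)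
    (h : ∀ x ∈ a, x < o) : ∃ b < o, ∀ x ∈ a, x < b := by
  rw [SmallSet, lift_cof] at ha
  refine ⟨_, sSup_add_one_lt_of_lt_cof ha h, fun x hx ↦ ?_⟩
  have hb : BddAbove ((· + 1) '' a) := by
    refine ⟨o, ?_⟩
    rintro _ ⟨y, hy, rfl⟩
    exact Order.add_one_le_of_lt (h y hy)
  exact (Order.lt_add_one_iff.2 le_rfl).trans_le (le_csSup hb ⟨x, hx, rfl⟩)

theorem exists_lt_ord (hc : c.IsRegular) {a : Set Ordinal.{u}} (ha : SmallSet c a)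
    (h : ∀ x ∈ a, x < c.ord) : ∃ b < c.ord, ∀ x ∈ a, x < b :=
  exists_lt (by rwa [hc.cof_ord]) h

theorem of_hasOtp {σ : Ordinal.{u}} {a : Set Ordinal.{u}} (h : HasOtp a σ) (hσ : σ < c.ord) :
    SmallSet c a := by
  have := congrArg Ordinal.card h
  rw [card_type, ← lift_card] at this
  rw [SmallSet, this, Cardinal.lift_lt]
  exact lt_ord.1 hσ

end SmallSet

theorem smallSet_succ_iff {μ : Cardinal.{u}} {α : Type (u + 1)} {a : Set α} :
    SmallSet (Order.succ μ) a ↔ #a ≤ Cardinal.lift.{u + 1} μ := by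
  rw [SmallSet, Cardinal.lift_succ, Order.lt_succ_iff]

theorem SmallSet.succ {μ : Cardinal.{u}} {α : Type (u + 1)} {a : Set α} (h : SmallSet μ a) :
    SmallSet (Order.succ μ) a :=
  smallSet_succ_iff.2 h.le

theorem ord_lt_ord_succ (μ : Cardinal.{u}) : μ.ord < (Order.succ μ).ord :=
  ord_lt_ord.2 (Order.lt_succ μ)

/-! ### Order types -/

theorem typeLT_Iio (o : Ordinal.{u}) : typeLT (Iio o) = Ordinal.lift.{u + 1} o := by
  simp

theorem hasOtp_of_card {c : Cardinal.{u}} {Y : Set Ordinal.{u}} (hY : Y ⊆ Iio c.ord)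
    (h : ¬ SmallSet c Y) : HasOtp Y c.ord := by
  refine le_antisymm ?_ ?_
  · rw [← typeLT_Iio]
    exact (RelEmbedding.ofMonotone (r := (· < ·)) (s := (· < ·))
      (fun x : Y ↦ (⟨x, hY x.2⟩ : Iio c.ord)) fun _ _ h ↦ h).ordinal_type_le
  · rw [lift_ord, ord_le, card_type]
    exact not_lt.1 h

theorem not_small_of_unbounded {c : Cardinal.{u}} (hc : c.IsRegular) {Y : Set Ordinal.{u}}
    (hY : Y ⊆ Iio c.ord) (h : ∀ ε < c.ord, ∃ v ∈ Y, ε ≤ v) : ¬ SmallSet c Y := by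
  intro hs
  obtain ⟨b, hb, hb'⟩ := hs.exists_lt_ord hc hY
  obtain ⟨v, hv, hv'⟩ := h b hb
  exact (hb' v hv).not_ge hv'

theorem exists_subset_hasOtp {c : Cardinal.{u}} {a : Set Ordinal.{u}} (h : ¬ SmallSet c a) :
    ∃ b ⊆ a, HasOtp b c.ord := by
  have : typeLT (Iio c.ord) ≤ typeLT a := by
    rw [typeLT_Iio, lift_ord, ord_le, card_type]
    exact not_lt.1 h
  obtain ⟨f⟩ := type_le_iff'.1 this
  refine ⟨range fun x ↦ (f x : Ordinal.{u}), ?_, ?_⟩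
  · rintro _ ⟨x, rfl⟩
    exact (f x).2
  · rw [HasOtp, ← typeLT_Iio, eq_comm]
    refine type_eq.2 ⟨RelIso.ofSurjective (RelEmbedding.ofMonotone
      (fun x ↦ ⟨f x, mem_range_self x⟩) fun x y hxy ↦ f.map_rel_iff.2 hxy) ?_⟩
    rintro ⟨_, x, rfl⟩
    exact ⟨x, rfl⟩

/-! ### Injections and enumerations -/

theorem exists_injOn_ord {c : Cardinal.{u}} {α : Type (u + 1)} {s : Set α}
    (h : #s ≤ Cardinal.lift.{u + 1} c) :
    ∃ f : α → Ordinal.{u}, InjOn f s ∧ MapsTo f s (Iio c.ord) := by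
  classical
  have : #s ≤ #(Iio c.ord) := by rwa [Cardinal.mk_Iio_ordinal, card_ord]
  obtain ⟨f⟩ := this
  refine ⟨fun x ↦ if hx : x ∈ s then f ⟨x, hx⟩ else 0, fun x hx y hy hxy ↦ ?_, fun x hx ↦ ?_⟩
  · simp only [hx, hy, dite_true] at hxy
    simpa using f.injective (Subtype.ext hxy)
  · simp only [hx, dite_true]
    exact (f ⟨x, hx⟩).2

/-- Inject `τ × c` into `Y` and read off the first coordinate. This is the coding device of the
whole proof: ordinals name requests, covers, sequences and labels, each name being used unboundedly
often. -/
theorem exists_unbounded_fibers {c : Cardinal.{u}} (hc : ℵ₀ ≤ c) {τ : Type (u + 1)} [Nonempty τ]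
    (hτ : #τ ≤ Cardinal.lift.{u + 1} c) {Y : Set Ordinal.{u}} (hY : ¬ SmallSet c Y) :
    ∃ f : Ordinal.{u} → τ, ∀ s, ∀ ε < c.ord, ∃ v ∈ Y, ε ≤ v ∧ f v = s := by
  classical
  have hc' : ℵ₀ ≤ Cardinal.lift.{u + 1} c := by
    exact aleph0_le_lift.2 hc
  have h1 : #(τ × Iio c.ord) ≤ #Y := by
    rw [mk_prod, Cardinal.lift_id, Cardinal.lift_id, Cardinal.mk_Iio_ordinal, card_ord]
    exact (mul_le_of_le hc' hτ le_rfl).trans (not_lt.1 hY)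
  obtain ⟨g⟩ := h1
  refine ⟨fun v ↦ if h : ∃ p, (g p : Ordinal.{u}) = v then h.choose.1 else Classical.arbitrary τ,
    fun s ε hε ↦ ?_⟩
  have h2 : ∃ i : Iio c.ord, ε ≤ (g (s, i) : Ordinal.{u}) := by
    by_contra! hcon
    have : #(Iio c.ord) ≤ #(Iio ε) :=
      ⟨⟨fun i ↦ ⟨g (s, i), hcon i⟩, fun i j hij ↦ by
        have := g.injective (Subtype.ext
            (Subtype.mk.inj hij : (g (s, i) : Ordinal.{u}) = g (s, j)))
        exact (Prod.ext_iff.1 this).2⟩⟩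
    have h3 := (SmallSet.Iio_iff (c := c)).2 hε
    rw [Cardinal.mk_Iio_ordinal, card_ord] at this
    exact (this.trans_lt h3).false
  obtain ⟨i, hi⟩ := h2
  refine ⟨g (s, i), (g (s, i)).2, hi, ?_⟩
  have hex : ∃ p, (g p : Ordinal.{u}) = g (s, i) := ⟨_, rfl⟩
  simp only [dif_pos hex]
  have := g.injective (Subtype.ext hex.choose_spec)
  rw [this]

/-! ### Closure points of functions on a successor cardinal -/

section Succ

variable {μ : Cardinal.{u}}

theorem succ_regular (hμ : μ.IsRegular) : (Order.succ μ).IsRegular :=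
  isRegular_succ hμ.aleph0_le

theorem lt_ord_succ_add_one (hμ : μ.IsRegular) {x : Ordinal.{u}} (hx : x < (Order.succ μ).ord) :
    Order.succ x < (Order.succ μ).ord :=
  (isSuccLimit_ord (succ_regular hμ).aleph0_le).succ_lt hx

theorem exists_ord_succ_bound (hμ : μ.IsRegular) {α : Type (u + 1)} {s : Set α}
    (hs : SmallSet (Order.succ μ) s) {f : α → Ordinal.{u}}
    (hf : ∀ i ∈ s, f i < (Order.succ μ).ord) :
    ∃ b < (Order.succ μ).ord, ∀ i ∈ s, f i < b := by
  obtain ⟨b, hb, h⟩ := (hs.image f).exists_lt_ord (succ_regular hμ) (by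
    rintro _ ⟨i, hi, rfl⟩
    exact hf i hi)
  exact ⟨b, hb, fun i hi ↦ h _ ⟨i, hi, rfl⟩⟩

theorem small_Iio_ord (μ : Cardinal.{u}) : SmallSet (Order.succ μ) (Iio μ.ord) :=
  SmallSet.Iio_iff.2 (ord_lt_ord_succ μ)

/-- Iterate `μ` times a function that dominates `g` on initial segments; the supremum of the
resulting increasing sequence is closed under `g`, and the length of the iteration gives its
cofinality. -/
theorem exists_closure_point (hμ : μ.IsRegular) {g : Ordinal.{u} → Ordinal.{u}}
    (hg : ∀ x < (Order.succ μ).ord, g x < (Order.succ μ).ord) {x₀ : Ordinal.{u}}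
    (hx₀ : x₀ < (Order.succ μ).ord) :
    ∃ d < (Order.succ μ).ord, x₀ < d ∧ d.cof = μ ∧ ∀ ε < d, g ε < d := by
  have h1 : ∀ x, ∃ y, x < (Order.succ μ).ord → y < (Order.succ μ).ord ∧ x < y ∧
      ∀ ε ≤ x, g ε < y := by
    intro x
    by_cases hx : x < (Order.succ μ).ord
    · obtain ⟨b, hb, h⟩ := exists_ord_succ_bound hμ (SmallSet.Iic (succ_regular hμ).aleph0_le hx)
        (f := fun y ↦ max y (g y)) fun y hy ↦ max_lt (lt_of_le_of_lt hy hx)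
          (hg _ (lt_of_le_of_lt hy hx))
      exact ⟨b, fun _ ↦ ⟨hb, (le_max_left _ _).trans_lt (h x (le_refl x)),
        fun ε hε ↦ (le_max_right _ _).trans_lt (h ε hε)⟩⟩
    · exact ⟨0, fun h ↦ absurd h hx⟩
  choose G hG using h1
  obtain ⟨p, hp⟩ : ∃ p : Ordinal.{u} → Ordinal.{u}, ∀ ξ,
      p ξ = max (Order.succ x₀) (⨆ i : Iio ξ, G (p i)) :=
    ⟨WellFounded.fix (C := fun _ ↦ Ordinal.{u}) Ordinal.lt_wf
      fun ξ r ↦ max (Order.succ x₀) (⨆ i : Iio ξ, G (r i.1 i.2)),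
      fun ξ ↦ WellFounded.fix_eq _ _ _⟩
  have hlt : ∀ ξ < μ.ord, p ξ < (Order.succ μ).ord := by
    intro ξ
    induction ξ using WellFoundedLT.induction with
    | ind ξ ih =>
      intro hξ
      rw [hp]
      refine max_lt (lt_ord_succ_add_one hμ hx₀) ?_
      obtain ⟨b, hb, h⟩ := exists_ord_succ_bound hμ (SmallSet.Iio_iff.2 (hξ.trans
        (ord_lt_ord_succ μ))) (f := fun i ↦ G (p i)) fun i hi ↦ (hG _ (ih i hi (lt_trans hi hξ))).1
      exact (Ordinal.iSup_le fun i : Iio ξ ↦ (h i i.2).le).trans_lt hb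
  have hle : ∀ η ξ, η < ξ → G (p η) ≤ p ξ := by
    intro η ξ h
    rw [hp ξ]
    exact (Ordinal.le_iSup (fun i : Iio ξ ↦ G (p i)) ⟨η, h⟩).trans (le_max_right _ _)
  have hmono : StrictMono fun i : Iio μ.ord ↦ p i := by
    intro i j hij
    exact (hG _ (hlt i i.2)).2.1.trans_le (hle _ _ hij)
  have hlim := isSuccLimit_ord hμ.aleph0_le
  have hx₀p : ∀ ξ, x₀ < p ξ := fun ξ ↦ by
    rw [hp]
    exact (Order.lt_succ x₀).trans_le (le_max_left _ _)
  refine ⟨⨆ i : Iio μ.ord, p i, ?_, ?_, ?_, ?_⟩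
  · obtain ⟨b, hb, h⟩ := exists_ord_succ_bound hμ (small_Iio_ord μ) hlt
    exact (Ordinal.iSup_le fun i : Iio μ.ord ↦ (h i i.2).le).trans_lt hb
  · exact (hx₀p 0).trans_le (Ordinal.le_iSup (fun i : Iio μ.ord ↦ p i) ⟨0, hμ.ord_pos⟩)
  · rw [cof_iSup_Iio hmono hlim.isSuccPrelimit, hμ.cof_ord]
  · intro ε hε
    obtain ⟨i, hi⟩ := Ordinal.lt_iSup_iff.1 hε
    have h2 := hlim.succ_lt i.2
    refine ((hG _ (hlt i i.2)).2.2 ε hi.le).trans_le ((hle _ _ (Order.lt_succ _)).trans ?_)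
    exact Ordinal.le_iSup (fun i : Iio μ.ord ↦ p i) ⟨_, h2⟩

theorem isClubIn_closurePoints (hμ : μ.IsRegular) {g : Ordinal.{u} → Ordinal.{u}}
    (hg : ∀ x < (Order.succ μ).ord, g x < (Order.succ μ).ord) {l : Ordinal.{u}}
    (hl : l < (Order.succ μ).ord) :
    IsClubIn (Order.succ μ).ord {d | d < (Order.succ μ).ord ∧ l < d ∧ ∀ ε < d, g ε < d} := by
  refine ⟨fun d hd ↦ hd.1, ?_, ?_⟩
  · intro s hs hne _ a ha
    refine ⟨a.2, ?_, fun ε hε ↦ ?_⟩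
    · obtain ⟨x, hx⟩ := hne
      exact (hs hx).2.1.trans_le (ha.1 hx)
    · have hε' : (⟨ε, lt_trans hε a.2⟩ : Iio (Order.succ μ).ord) < a := hε
      obtain ⟨x, hx, hx'⟩ := (lt_isLUB_iff ha).1 hε'
      exact ((hs hx).2.2 ε hx').trans_le (ha.1 hx)
  · intro x
    obtain ⟨d, hd, hxd, -, h⟩ := exists_closure_point hμ hg (max_lt x.2 hl)
    exact ⟨⟨d, hd⟩, ⟨hd, (le_max_right _ _).trans_lt hxd, h⟩, ((le_max_left _ _).trans_lt hxd).le⟩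

/-- Let `g` send each point to a larger member of `t`: a closure point is then a limit of members.
Arguments about clubs thus become arguments about closure points of functions. -/
theorem IsClub.exists_closure (hμ : μ.IsRegular) {t : Set (Iio (Order.succ μ).ord)}
    (ht : IsClub t) : ∃ g : Ordinal.{u} → Ordinal.{u},
      (∀ x < (Order.succ μ).ord, x < g x ∧ g x < (Order.succ μ).ord) ∧
      ∀ d, ∀ hd : d < (Order.succ μ).ord, 0 < d → (∀ ε < d, g ε < d) →
        (⟨d, hd⟩ : Iio (Order.succ μ).ord) ∈ t := by
  have h1 : ∀ x, ∃ y, ∀ hx : x < (Order.succ μ).ord, x < y ∧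
      ∃ hy : y < (Order.succ μ).ord, (⟨y, hy⟩ : Iio (Order.succ μ).ord) ∈ t := by
    intro x
    by_cases hx : x < (Order.succ μ).ord
    · obtain ⟨y, hy, hy'⟩ := ht.isCofinal ⟨_, lt_ord_succ_add_one hμ hx⟩
      exact ⟨y, fun _ ↦ ⟨(Order.lt_succ x).trans_le hy', y.2, hy⟩⟩
    · exact ⟨0, fun h ↦ absurd h hx⟩
  choose g hg using h1
  refine ⟨g, fun x hx ↦ ⟨(hg x hx).1, (hg x hx).2.1⟩, fun d hd h0 hcl ↦ ?_⟩
  refine ht.isLUB_mem (t := {x | x ∈ t ∧ (x : Ordinal.{u}) < d}) (fun x hx ↦ hx.1) ?_ ⟨?_, ?_⟩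
  · obtain ⟨-, hy, h⟩ := hg 0 (h0.trans hd)
    exact ⟨⟨_, hy⟩, h, hcl 0 h0⟩
  · exact fun x hx ↦ hx.2.le
  · intro b hb
    by_contra! hlt
    obtain ⟨h1, hy, h⟩ := hg b b.2
    have h2 : (⟨g b, hy⟩ : Iio (Order.succ μ).ord) ∈
        {x | x ∈ t ∧ (x : Ordinal.{u}) < d} := ⟨h, hcl b hlt⟩
    exact (show g b ≤ b from hb h2).not_gt h1

theorem isStationaryIn_of_closure (hμ : μ.IsRegular) {S : Set Ordinal.{u}}
    (h : ∀ g : Ordinal.{u} → Ordinal.{u}, (∀ x < (Order.succ μ).ord, g x < (Order.succ μ).ord) →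
      ∃ d ∈ S, d < (Order.succ μ).ord ∧ 0 < d ∧ ∀ ε < d, g ε < d) :
    IsStationaryIn (Order.succ μ).ord S := by
  intro t ht
  obtain ⟨g, hg, hg'⟩ := ht.exists_closure hμ
  obtain ⟨d, hdS, hd, h0, hcl⟩ := h g fun x hx ↦ (hg x hx).2
  exact ⟨⟨d, hd⟩, hdS, hg' d hd h0 hcl⟩

theorem IsStationaryIn.exists_closure (hμ : μ.IsRegular) {S : Set Ordinal.{u}}
    (hS : IsStationaryIn (Order.succ μ).ord S) {g : Ordinal.{u} → Ordinal.{u}}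
    (hg : ∀ x < (Order.succ μ).ord, g x < (Order.succ μ).ord) {l : Ordinal.{u}}
    (hl : l < (Order.succ μ).ord) :
    ∃ d ∈ S, d < (Order.succ μ).ord ∧ l < d ∧ ∀ ε < d, g ε < d := by
  obtain ⟨d, h1, h2⟩ := hS (isClubIn_closurePoints hμ hg hl).2
  exact ⟨d, h1, h2⟩

theorem isStationaryIn_cofSet (hμ : μ.IsRegular) :
    IsStationaryIn (Order.succ μ).ord (cofSet (Order.succ μ) μ) := by
  refine isStationaryIn_of_closure hμ fun g hg ↦ ?_
  obtain ⟨d, hd, h0, hc, h⟩ := exists_closure_point hμ hg (succ_regular hμ).ord_pos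
  exact ⟨d, ⟨hd, hc⟩, hd, h0, h⟩

theorem PL2.mono {κ χ : Cardinal.{u}} {Γ Γ' : Set Ordinal.{u}} (h : PL2 κ Γ χ) (hΓ : Γ' ⊆ Γ)
    (hs : IsStationaryIn κ.ord Γ') : PL2 κ Γ' χ := by
  obtain ⟨h1, -, t, ht, h2⟩ := h
  refine ⟨hΓ.trans h1, hs, t, ht, fun σ hσ 𝒜 h𝒜 ↦ ?_⟩
  obtain ⟨D, hD, h⟩ := h2 σ hσ 𝒜 h𝒜
  exact ⟨D, hD, fun α hα β hβ ↦ h α ⟨hΓ hα.1, hα.2⟩ β ⟨hΓ hβ.1, hβ.2⟩⟩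

/-- A weak pressing-down lemma. Otherwise each `l` has a bound `g l` from which on `lam` exceeds
`l`, and a closure point `d` of `g` of cofinality `μ` contradicts this for `l = lam d`. -/
theorem exists_bound_unbounded (hμ : μ.IsRegular) {lam : Ordinal.{u} → Ordinal.{u}}
    (h : ∀ η < (Order.succ μ).ord, η.cof = μ → lam η < η) :
    ∃ l < (Order.succ μ).ord, ∀ ε < (Order.succ μ).ord,
      ∃ η < (Order.succ μ).ord, ε ≤ η ∧ η.cof = μ ∧ lam η ≤ l := by
  by_contra! hcon
  choose! g hg hg' using hcon
  obtain ⟨d, hd, -, hc, hcl⟩ := exists_closure_point hμ hg (succ_regular hμ).ord_pos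
  have h1 := h d hd hc
  exact (hg' _ (h1.trans hd) d hd (hcl _ h1).le hc).false

theorem exists_fiber_unbounded (hμ : μ.IsRegular) {P : Ordinal.{u} → Prop}
    (hP : ∀ ε < (Order.succ μ).ord, ∃ x, ε ≤ x ∧ P x) {f : Ordinal.{u} → Ordinal.{u}}
    (hf : ∀ x, P x → f x < μ.ord) :
    ∃ k < μ.ord, ∀ ε < (Order.succ μ).ord, ∃ x, ε ≤ x ∧ P x ∧ f x = k := by
  by_contra! hcon
  choose! g hg hg' using hcon
  obtain ⟨b, hb, h⟩ := exists_ord_succ_bound hμ (small_Iio_ord μ) hg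
  obtain ⟨x, hx, hPx⟩ := hP b hb
  exact hg' _ (hf x hPx) x ((h _ (hf x hPx)).le.trans hx) hPx rfl

/-! ### Disjoint families -/

/-- If every member had an element below `ε`, disjointness would inject the family into `ε`. -/
theorem IsDisjointFamily.exists_above {κ : Cardinal.{u}} {σ : Ordinal.{u}}
    {𝒜 : Set (Set Ordinal.{u})} (h : IsDisjointFamily κ σ 𝒜) {ε : Ordinal.{u}} (hε : ε < κ.ord) :
    ∃ a ∈ 𝒜, ∀ α ∈ a, ε ≤ α := by
  by_contra! hcon
  choose! f hf hf' using hcon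
  have h1 : #𝒜 ≤ #(Iio ε) := by
    refine ⟨⟨fun a ↦ ⟨f a, hf' a a.2⟩, fun a b hab ↦ ?_⟩⟩
    by_contra hne
    have hab' : f a = f b := Subtype.mk.inj hab
    refine (disjoint_left.1 (h.2.1 a a.2 b b.2 fun h ↦ hne (Subtype.ext h))) (hf a a.2) ?_
    rw [hab']
    exact hf b b.2
  rw [h.2.2] at h1
  exact (h1.trans_lt ((SmallSet.Iio_iff (c := κ)).2 hε)).false

theorem IsDisjointFamily.nonempty {κ : Cardinal.{u}} (hκ : ℵ₀ ≤ κ) {σ : Ordinal.{u}}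
    {𝒜 : Set (Set Ordinal.{u})} (h : IsDisjointFamily κ σ 𝒜) {a : Set Ordinal.{u}} (ha : a ∈ 𝒜) :
    a.Nonempty := by
  by_contra hne
  rw [not_nonempty_iff_eq_empty] at hne
  have h0 : ∀ b ∈ 𝒜, b = ∅ := by
    intro b hb
    have h1 := (h.1 ha).2
    have h2 := (h.1 hb).2
    rw [HasOtp] at h1 h2
    rw [hne, ← h2, type_eq_zero_iff_isEmpty.2 inferInstance] at h1
    replace h1 := h1.symm
    exact isEmpty_coe_sort.1 (type_eq_zero_iff_isEmpty.1 h1)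
  have h1 : SmallSet κ 𝒜 := SmallSet.of_finite hκ
    ((finite_singleton ∅).subset fun b hb ↦ h0 b hb)
  rw [SmallSet, h.2.2] at h1
  exact h1.false

theorem IsDisjointFamily.small {κ χ : Cardinal.{u}} {σ : Ordinal.{u}} (hσ : σ < χ.ord)
    {𝒜 : Set (Set Ordinal.{u})} (h : IsDisjointFamily κ σ 𝒜) {a : Set Ordinal.{u}} (ha : a ∈ 𝒜) :
    SmallSet χ a :=
  .of_hasOtp (h.1 ha).2 hσ

end Succ

/-! ### Ladder systems -/

/-- The ladder `E` has no accumulation at `x`. -/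
def BoundedBelow (E : Set Ordinal.{u}) (x : Ordinal.{u}) : Prop :=
  ∃ l < x, ∀ c ∈ E, c < x → c ≤ l

theorem BoundedBelow.of_small {E : Set Ordinal.{u}} {x : Ordinal.{u}}
    (h : SmallSet x.cof (E ∩ Iio x)) : BoundedBelow E x := by
  obtain ⟨b, hb, hb'⟩ := h.exists_lt fun y hy ↦ hy.2
  exact ⟨b, hb, fun c hc hcx ↦ (hb' c ⟨hc, hcx⟩).le⟩

/-- A ladder of order type `cf ζ` has fewer than `cf ζ` rungs below any `x < ζ`, so it is bounded
below `x` when `cf x ≥ cf ζ`; this covers cofinality `μ`. For a limit `x ∈ S` of smaller cofinality,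
`cf ζ` is uncountable and nonreflection gives a club of `ζ` disjoint from `S`; a ladder inside it
cannot accumulate at `x`. -/
theorem exists_ladder {μ : Cardinal.{u}} (hμ : μ.IsRegular) {S : Set Ordinal.{u}}
    (hS : ∀ α < (Order.succ μ).ord, ℵ₀ < α.cof → ¬ IsStationaryIn α S) :
    ∃ E : Ordinal.{u} → Set Ordinal.{u}, ∀ ζ < (Order.succ μ).ord, IsCofinalIn ζ (E ζ) ∧
      ∀ x < ζ, x.cof = μ ∨ (x ∈ S ∧ Order.IsSuccLimit x) → BoundedBelow (E ζ) x := by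
  have h1 : ∀ ζ, ∃ E, ζ < (Order.succ μ).ord → IsCofinalIn ζ E ∧
      ∀ x < ζ, x.cof = μ ∨ (x ∈ S ∧ Order.IsSuccLimit x) → BoundedBelow E x := by
    intro ζ
    by_cases hζ : ζ < (Order.succ μ).ord
    swap
    · exact ⟨∅, fun h ↦ absurd h hζ⟩
    have hxlim : ∀ x : Ordinal.{u}, x.cof = μ ∨ (x ∈ S ∧ Order.IsSuccLimit x) →
        Order.IsSuccLimit x := by
      rintro x (h | h)
      · exact Ordinal.one_lt_cof_iff.1 (h ▸ one_lt_aleph0.trans_le hμ.aleph0_le)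
      · exact h.2
    rcases Ordinal.zero_or_succ_or_isSuccLimit ζ with rfl | ⟨p, rfl⟩ | hlim
    · exact ⟨∅, fun _ ↦ ⟨⟨empty_subset _, fun β hβ ↦ absurd hβ not_lt_zero⟩,
        fun x hx ↦ absurd hx not_lt_zero⟩⟩
    · refine ⟨{p}, fun _ ↦ ⟨⟨?_, ?_⟩, ?_⟩⟩
      · exact singleton_subset_iff.2 (Order.lt_succ p)
      · exact fun β hβ ↦ ⟨p, rfl, Order.lt_succ_iff.1 hβ⟩
      · rintro x hx hx'
        refine ⟨0, (hxlim x hx').bot_lt, ?_⟩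
        rintro _ rfl hc
        exact absurd (Order.lt_succ_iff.1 hx) hc.not_ge
    · have hcof : Order.cof (Iio ζ) = Cardinal.lift.{u + 1} ζ.cof := by
        rw [cof_Iio, lift_cof]
      obtain ⟨C', hC', hC''⟩ : ∃ C' : Set (Iio ζ), IsCofinal C' ∧ ∀ x : Iio ζ,
          (x : Ordinal.{u}) ∈ S → ℵ₀ < ζ.cof →
            ∀ t ⊆ C', t.Nonempty → ¬ IsLUB t x := by
        by_cases h : ℵ₀ < ζ.cof
        · obtain ⟨t, ht, htS⟩ := not_isStationary_iff.1 (hS ζ hζ h)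
          exact ⟨t, ht.isCofinal, fun x hx _ s hs hne hl ↦
            disjoint_left.1 htS hx (ht.isLUB_mem hs hne hl)⟩
        · exact ⟨univ, .univ, fun x _ h' ↦ absurd h' h⟩
      obtain ⟨t, htC, ht, htype⟩ := exists_ord_cof_eq_of_isCofinal hC'
      have hsmall : ∀ x < ζ, SmallSet ζ.cof (Subtype.val '' t ∩ Iio x) := by
        intro x hx
        obtain ⟨z, hz, hxz⟩ := ht ⟨x, hx⟩
        have hcard : #t = Order.cof (Iio ζ) := by
          rw [← card_type (· < · : t → t → Prop), htype, card_ord]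
        have h2 : #(Iio (⟨z, hz⟩ : t)) < #t := mk_Iio_lt _ (by rw [htype, hcard])
        rw [hcard, hcof] at h2
        have h3 : Subtype.val '' t ∩ Iio x ⊆
            (fun y : t ↦ ((y : Iio ζ) : Ordinal.{u})) '' Iio (⟨z, hz⟩ : t) := by
          rintro _ ⟨⟨y, hy, rfl⟩, hyx⟩
          exact ⟨⟨y, hy⟩, lt_of_lt_of_le hyx hxz, rfl⟩
        exact ((mk_le_mk_of_subset h3).trans mk_image_le).trans_lt h2
      refine ⟨Subtype.val '' t, fun _ ↦ ⟨⟨?_, ?_⟩, ?_⟩⟩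
      · rintro _ ⟨y, -, rfl⟩
        exact y.2
      · intro β hβ
        obtain ⟨z, hz, hz'⟩ := ht ⟨β, hβ⟩
        exact ⟨z, ⟨z, hz, rfl⟩, hz'⟩
      · intro x hx hx'
        have hcofμ : ζ.cof ≤ μ :=
          (cof_le_card ζ).trans (Order.lt_succ_iff.1 (lt_ord.1 hζ))
        by_cases h : ζ.cof ≤ x.cof
        · exact .of_small ((hsmall x hx).trans_le (Cardinal.lift_le.2 h))
        · have hxS : x ∈ S := by
            refine (hx'.resolve_left fun h' ↦ h ?_).1
            rwa [h']
          have hω : ℵ₀ < ζ.cof := by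
            refine lt_of_le_of_lt ?_ (not_le.1 h)
            exact Ordinal.aleph0_le_cof_iff.2 (Ordinal.one_lt_cof_iff.2 (hxlim x hx'))
          by_contra hb
          have hb' : ∀ l < x, ∃ c : Iio ζ, c ∈ t ∧ (c : Ordinal.{u}) < x ∧ l < c := by
            intro l hl
            by_contra! hcon
            refine hb ⟨l, hl, ?_⟩
            rintro _ ⟨c, hc, rfl⟩ hcx
            exact hcon c hc hcx
          refine hC'' ⟨x, hx⟩ hxS hω {c | c ∈ t ∧ (c : Ordinal.{u}) < x} (fun c hc ↦ htC hc.1)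
            ?_ ⟨fun c hc ↦ hc.2.le, fun b hb ↦ ?_⟩
          · obtain ⟨c, hc, hcx, -⟩ := hb' 0 (hxlim x hx').bot_lt
            exact ⟨c, hc, hcx⟩
          · by_contra hlt
            obtain ⟨c, hc, hcx, hbc⟩ := hb' b (not_le.1 hlt)
            have h3 : c ∈ {c | c ∈ t ∧ (c : Ordinal.{u}) < x} := ⟨hc, hcx⟩
            exact (show c ≤ b from hb h3).not_gt hbc
  choose E hE using h1
  exact ⟨E, hE⟩

/-! ### Walks -/

/-- The step from `ζ` towards `α` along the ladder system `C`. -/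
noncomputable def walkStep (C : Ordinal.{u} → Set Ordinal.{u}) (α ζ : Ordinal.{u}) : Ordinal.{u} :=
  sInf {c | c ∈ C ζ ∧ α ≤ c}

open Classical in
/-- The walk from `ζ` down to `α` along `C`, as the list of its steps. -/
noncomputable def walk (C : Ordinal.{u} → Set Ordinal.{u}) (α ζ : Ordinal.{u}) :
    List (Ordinal.{u} × Ordinal.{u}) :=
  if _h : α < ζ ∧ walkStep C α ζ < ζ then (ζ, walkStep C α ζ) :: walk C α (walkStep C α ζ) else []
termination_by ζ
decreasing_by exact _h.2

theorem walk_of_le {C : Ordinal.{u} → Set Ordinal.{u}} {α ζ : Ordinal.{u}} (h : ζ ≤ α) :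
    walk C α ζ = [] := by
  rw [walk, dif_neg fun h' ↦ h.not_gt h'.1]

theorem walkStep_spec {C : Ordinal.{u} → Set Ordinal.{u}} {α ζ : Ordinal.{u}}
    (hC : IsCofinalIn ζ (C ζ)) (h : α < ζ) :
    walkStep C α ζ ∈ C ζ ∧ α ≤ walkStep C α ζ ∧ walkStep C α ζ < ζ := by
  obtain ⟨c, hc, hαc⟩ := hC.2 α h
  have := csInf_mem (s := {c | c ∈ C ζ ∧ α ≤ c}) ⟨c, hc, hαc⟩
  exact ⟨this.1, this.2, hC.1 this.1⟩

theorem walkStep_le {C : Ordinal.{u} → Set Ordinal.{u}} {α ζ c : Ordinal.{u}}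
    (hc : c ∈ C ζ) (h : α ≤ c) : walkStep C α ζ ≤ c :=
  csInf_le' ⟨hc, h⟩

theorem walk_of_lt {C : Ordinal.{u} → Set Ordinal.{u}} {α ζ : Ordinal.{u}}
    (hC : IsCofinalIn ζ (C ζ)) (h : α < ζ) :
    walk C α ζ = (ζ, walkStep C α ζ) :: walk C α (walkStep C α ζ) := by
  rw [walk, dif_pos ⟨h, (walkStep_spec hC h).2.2⟩]

theorem mem_walk {C : Ordinal.{u} → Set Ordinal.{u}} {o α ζ : Ordinal.{u}}
    (hC : ∀ ζ < o, IsCofinalIn ζ (C ζ)) (hζ : ζ < o) {p : Ordinal.{u} × Ordinal.{u}}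
    (hp : p ∈ walk C α ζ) : α < p.1 ∧ p.1 ≤ ζ ∧ p.2 ∈ C p.1 ∧ α ≤ p.2 ∧ p.2 < p.1 := by
  induction ζ using WellFoundedLT.induction with
  | ind ζ ih =>
    rcases le_or_gt ζ α with h | h
    · simp [walk_of_le h] at hp
    · obtain ⟨h1, h2, h3⟩ := walkStep_spec (hC ζ hζ) h
      rw [walk_of_lt (hC ζ hζ) h, List.mem_cons] at hp
      rcases hp with rfl | hp
      · exact ⟨h, le_rfl, h1, h2, h3⟩
      · obtain ⟨h4, h5, h6⟩ := ih _ h3 (h3.trans hζ) hp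
        exact ⟨h4, h5.trans h3.le, h6⟩

/-- The walk from `β` to `x` consults finitely many ladders, each with its rungs below `x` bounded
below `x`. Past these bounds, the first rung at or above `α` is the first rung at or above `x`. -/
theorem exists_walk_append {C : Ordinal.{u} → Set Ordinal.{u}} {o x β : Ordinal.{u}}
    (hC : ∀ ζ < o, IsCofinalIn ζ (C ζ)) (hβ : β < o) (hx : 0 < x) (hxβ : x ≤ β)
    (hb : ∀ ζ < o, x < ζ → BoundedBelow (C ζ) x) :
    ∃ l < x, ∀ α, l < α → α ≤ x → walk C α β = walk C x β ++ walk C α x := by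
  induction β using WellFoundedLT.induction with
  | ind β ih =>
    rcases hxβ.eq_or_lt with rfl | h
    · exact ⟨0, hx, fun α _ _ ↦ by rw [walk_of_le le_rfl, List.nil_append]⟩
    · obtain ⟨l, hl, hl'⟩ := hb β hβ h
      obtain ⟨h1, h2, h3⟩ := walkStep_spec (hC β hβ) h
      obtain ⟨l2, hl2, hl2'⟩ := ih _ h3 (h3.trans hβ) h2
      refine ⟨max l l2, max_lt hl hl2, fun α hα hαx ↦ ?_⟩
      have hstep : walkStep C α β = walkStep C x β := by
        obtain ⟨h4, h5, h6⟩ := walkStep_spec (hC β hβ) (hαx.trans_lt h)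
        refine le_antisymm (walkStep_le h1 (hαx.trans h2)) (walkStep_le h4 ?_)
        by_contra hlt
        exact (((le_max_left _ _).trans_lt hα).trans_le h5).not_ge (hl' _ h4 (not_le.1 hlt))
      rw [walk_of_lt (hC β hβ) (hαx.trans_lt h), walk_of_lt (hC β hβ) h, hstep,
        hl2' α ((le_max_right _ _).trans_lt hα) hαx, List.cons_append]

theorem walk_eq_append_of_mem {C : Ordinal.{u} → Set Ordinal.{u}} {o α ζ v : Ordinal.{u}}
    (hC : ∀ ζ < o, IsCofinalIn ζ (C ζ)) (hζ : ζ < o) (hv : v ∈ C ζ) (hαv : α ≤ v)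
    (hmin : ∀ c ∈ C ζ, α ≤ c → v ≤ c) : walk C α ζ = (ζ, v) :: walk C α v := by
  have h := hαv.trans_lt ((hC ζ hζ).1 hv)
  rw [walk_of_lt (hC ζ hζ) h, show walkStep C α ζ = v from
    le_antisymm (walkStep_le hv hαv)
      (hmin _ (walkStep_spec (hC ζ hζ) h).1 (walkStep_spec (hC ζ hζ) h).2.1)]

/-! ### Codes and blocks -/

theorem SmallSet.of_injOn {c : Cardinal.{u}} {α β : Type (u + 1)} {f : α → β} {s : Set α}
    {t : Set β} (ht : SmallSet c t) (hf : InjOn f s) (hst : MapsTo f s t) : SmallSet c s := by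
  rw [SmallSet, ← mk_image_eq_of_injOn f s hf]
  exact ht.mono hst.image_subset

theorem SmallSet.prod {c : Cardinal.{u}} (hc : ℵ₀ ≤ c) {α β : Type (u + 1)} {s : Set α}
    {t : Set β} (hs : SmallSet c s) (ht : SmallSet c t) : SmallSet c (s ×ˢ t) := by
  rw [SmallSet, mk_setProd]
  exact mul_lt_of_lt (aleph0_le_lift.2 hc) hs ht

theorem small_lists {c : Cardinal.{u}} (hc : ℵ₀ < c) {α : Type (u + 1)} {s : Set α}
    (hs : SmallSet c s) : SmallSet c {l : List α | ∀ x ∈ l, x ∈ s} := by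
  have h : {l : List α | ∀ x ∈ l, x ∈ s} = range (List.map ((↑) : s → α)) :=
    (range_list_map_coe s).symm
  rw [SmallSet, h]
  exact mk_range_le.trans_lt ((mk_list_le_max s).trans_lt (max_lt (aleph0_lt_lift.2 hc) hs))

variable {μ : Cardinal.{u}}

theorem exists_codes (μ : Cardinal.{u}) : ∃ e : Ordinal.{u} → Ordinal.{u} → Ordinal.{u},
    ∀ ζ < (Order.succ μ).ord, InjOn (e ζ) (Iio ζ) ∧ MapsTo (e ζ) (Iio ζ) (Iio μ.ord) := by
  have h : ∀ ζ, ∃ f : Ordinal.{u} → Ordinal.{u}, ζ < (Order.succ μ).ord →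
      InjOn f (Iio ζ) ∧ MapsTo f (Iio ζ) (Iio μ.ord) := by
    intro ζ
    by_cases hζ : ζ < (Order.succ μ).ord
    · obtain ⟨f, hf⟩ := exists_injOn_ord (smallSet_succ_iff.1 (SmallSet.Iio_iff.2 hζ))
      exact ⟨f, fun _ ↦ hf⟩
    · exact ⟨id, fun h ↦ absurd h hζ⟩
  choose e he using h
  exact ⟨e, he⟩

theorem not_small_Iio_ord (c : Cardinal.{u}) : ¬ SmallSet c (Iio c.ord) :=
  fun h ↦ (SmallSet.Iio_iff.1 h).false

/-- There may be too many sets of size less than `μ` to enumerate them, so they are covered instead: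
a small `a ⊆ b` lies in `{α < b | e b α < r}` for some `r < μ`. The triples `(d, b, r)`, with `d` a
lower bound, can be coded by ordinals below `μ⁺`. -/
theorem exists_blocks (hμ : μ.IsRegular) : ∃ K : Ordinal.{u} → Set Ordinal.{u},
    (∀ v, SmallSet μ (K v) ∧ K v ⊆ Iio v) ∧
    ∀ a : Set Ordinal.{u}, SmallSet μ a → (∀ α ∈ a, α < (Order.succ μ).ord) →
      ∀ d < (Order.succ μ).ord, (∀ α ∈ a, d ≤ α) → ∀ ε < (Order.succ μ).ord,
        ∃ v, ε ≤ v ∧ v < (Order.succ μ).ord ∧ a ⊆ K v ∧ ∀ α ∈ K v, d ≤ α := by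
  obtain ⟨e, he⟩ := exists_codes μ
  have hκ := (succ_regular hμ).aleph0_le
  have hpos : 0 < (Order.succ μ).ord := (succ_regular hμ).ord_pos
  let τ := {x : Ordinal.{u} × Ordinal.{u} × Ordinal.{u} //
    x ∈ Iio (Order.succ μ).ord ×ˢ (Iio (Order.succ μ).ord ×ˢ Iio μ.ord)}
  have : Nonempty τ := ⟨⟨(0, 0, 0), hpos, hpos, hμ.ord_pos⟩⟩
  have hτ : #τ ≤ Cardinal.lift.{u + 1} (Order.succ μ) := by
    change #(Iio (Order.succ μ).ord ×ˢ (Iio (Order.succ μ).ord ×ˢ Iio μ.ord) : Set _) ≤ _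
    simp only [mk_setProd, Cardinal.mk_Iio_ordinal, card_ord]
    have hκ' := aleph0_le_lift.{u, u + 1}.2 hκ
    exact mul_le_of_le hκ' le_rfl (mul_le_of_le hκ' le_rfl
      (Cardinal.lift_le.2 (Order.le_succ μ)))
  obtain ⟨f, hf⟩ := exists_unbounded_fibers hκ hτ (not_small_Iio_ord _)
  refine ⟨fun v ↦ {α | (f v).1.1 ≤ α ∧ α < v ∧ α < (f v).1.2.1 ∧
    e (f v).1.2.1 α < (f v).1.2.2}, fun v ↦ ⟨?_, fun α hα ↦ hα.2.1⟩, ?_⟩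
  · obtain ⟨-, h1, h2⟩ := (f v).2
    refine (SmallSet.Iio_iff.2 h2).of_injOn (f := e (f v).1.2.1) ?_ fun α hα ↦ hα.2.2.2
    exact (he _ h1).1.mono fun α hα ↦ hα.2.2.1
  · intro a ha hao d hd hda ε hε
    obtain ⟨b, hb, hab⟩ := exists_ord_succ_bound hμ ha.succ hao
    obtain ⟨r, hr, har⟩ := (ha.image (e b)).exists_lt_ord hμ (by
      rintro _ ⟨α, hα, rfl⟩
      exact (he b hb).2 (hab α hα))
    obtain ⟨v, hv, hεv, hfv⟩ := hf ⟨(d, b, r), hd, hb, hr⟩ (max ε b) (max_lt hε hb)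
    refine ⟨v, (le_max_left _ _).trans hεv, hv, fun α hα ↦ ?_, fun α hα ↦ ?_⟩
    · simp only [hfv, mem_ofPred_eq]
      exact ⟨hda α hα, (hab α hα).trans_le ((le_max_right _ _).trans hεv), hab α hα,
        har _ ⟨α, hα, rfl⟩⟩
    · simp only [hfv, mem_ofPred_eq] at hα
      exact hα.1

/-! ### Almost disjoint refinement at one stage -/

/-- A recursion of length `μ` visiting each request unboundedly often. Step `k` picks a block
avoiding those picked earlier and also the first blocks, up to index `k`, of the requests visited up
to step `k`. The last clause, late picks avoiding early blocks, is what handles infinite sets of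
stages. -/
theorem exists_stage (hμ : μ.IsRegular) {τ : Type (u + 1)} [Nonempty τ]
    (hτ : #τ ≤ Cardinal.lift.{u + 1} μ) (blk : τ → Ordinal.{u} → Set Ordinal.{u})
    (hsmall : ∀ s, ∀ i < μ.ord, SmallSet μ (blk s i))
    (hsc : ∀ s H, SmallSet μ H → ∀ i₀ < μ.ord, ∃ i < μ.ord, i₀ ≤ i ∧ Disjoint (blk s i) H) :
    ∃ (tk : Ordinal.{u} → τ) (idx : Ordinal.{u} → Ordinal.{u}),
      (∀ k < μ.ord, idx k < μ.ord) ∧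
      (∀ j k, j < k → k < μ.ord → Disjoint (blk (tk k) (idx k)) (blk (tk j) (idx j))) ∧
      (∀ s, ∀ i₀ < μ.ord, ∃ k < μ.ord, tk k = s ∧ i₀ ≤ idx k) ∧
      ∀ s, ∃ k₀ < μ.ord, ∀ k < μ.ord, k₀ ≤ k → ∀ i ≤ k,
        Disjoint (blk (tk k) (idx k)) (blk s i) := by
  obtain ⟨f, hf⟩ := exists_unbounded_fibers hμ.aleph0_le hτ (not_small_Iio_ord _)
  have h1 : ∀ k H, ∃ i, k < μ.ord → SmallSet μ H → i < μ.ord ∧ k ≤ i ∧ Disjoint (blk (f k) i) H := by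
    intro k H
    by_cases h : k < μ.ord ∧ SmallSet μ H
    · obtain ⟨i, hi⟩ := hsc (f k) H h.2 k h.1
      exact ⟨i, fun _ _ ↦ hi⟩
    · exact ⟨0, fun h2 h3 ↦ absurd ⟨h2, h3⟩ h⟩
  choose F hF using h1
  obtain ⟨idx, hidx⟩ : ∃ p : Ordinal.{u} → Ordinal.{u}, ∀ k,
      p k = F k ((⋃ j : Iio k, blk (f j) (p j)) ∪ ⋃ j ∈ Iic k, ⋃ i ∈ Iic k, blk (f j) i) :=
    ⟨WellFounded.fix (C := fun _ ↦ Ordinal.{u}) Ordinal.lt_wf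
      fun k r ↦ F k ((⋃ j : Iio k, blk (f j.1) (r j.1 j.2)) ∪
        ⋃ j ∈ Iic k, ⋃ i ∈ Iic k, blk (f j) i),
      fun k ↦ WellFounded.fix_eq _ _ _⟩
  have key : ∀ k < μ.ord, idx k < μ.ord ∧ k ≤ idx k ∧ Disjoint (blk (f k) (idx k))
      ((⋃ j : Iio k, blk (f j) (idx j)) ∪ ⋃ j ∈ Iic k, ⋃ i ∈ Iic k, blk (f j) i) := by
    intro k
    induction k using WellFoundedLT.induction with
    | ind k ih =>
      intro hk
      have := hF k ((⋃ j : Iio k, blk (f j) (idx j)) ∪ ⋃ j ∈ Iic k, ⋃ i ∈ Iic k, blk (f j) i) hk ?_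
      · rwa [← hidx] at this
      · refine .union hμ.aleph0_le ?_ ?_
        · have h2 : (⋃ j : Iio k, blk (f j) (idx j)) = ⋃ j ∈ Iio k, blk (f j) (idx j) := by
            rw [iUnion_subtype]
          rw [h2]
          exact .biUnion hμ (SmallSet.Iio_iff.2 hk) fun j hj ↦
            hsmall _ _ (ih j hj (lt_trans hj hk)).1
        · have h3 := SmallSet.Iic hμ.aleph0_le hk
          exact .biUnion hμ h3 fun j hj ↦ .biUnion hμ h3 fun i hi ↦
            hsmall _ _ (lt_of_le_of_lt hi hk)
  refine ⟨f, idx, fun k hk ↦ (key k hk).1, fun j k hjk hk ↦ ?_, fun s i₀ hi₀ ↦ ?_, fun s ↦ ?_⟩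
  · exact (key k hk).2.2.mono_right ((subset_iUnion (fun j : Iio k ↦ blk (f j) (idx j))
      ⟨j, hjk⟩).trans subset_union_left)
  · obtain ⟨k, hk, hik, hfk⟩ := hf s i₀ hi₀
    exact ⟨k, hk, hfk, hik.trans (key k hk).2.1⟩
  · obtain ⟨k₀, hk₀, -, rfl⟩ := hf s 0 hμ.ord_pos
    refine ⟨k₀, hk₀, fun k hk hkk i hi ↦ (key k hk).2.2.mono_right (subset_union_of_subset_right
      (fun x hx ↦ ?_) _)⟩
    simp only [mem_iUnion, exists_prop]
    exact ⟨k₀, hkk, i, hi, hx⟩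

/-! ### Almost disjoint colourings along blocks -/

/-- The sets `x i`, `i < μ`, are small and pairwise disjoint. -/
def IsBlockSeq (μ : Cardinal.{u}) (x : Ordinal.{u} → Set Ordinal.{u}) : Prop :=
  (∀ i < μ.ord, SmallSet μ (x i)) ∧ ∀ i j, i < j → j < μ.ord → Disjoint (x i) (x j)

/-- Each point of `H` lies in at most one block, so fewer than `μ` blocks meet `H`. -/
theorem IsBlockSeq.exists_disjoint_tail (hμ : μ.IsRegular) {x : Ordinal.{u} → Set Ordinal.{u}}
    (hx : IsBlockSeq μ x) {H : Set Ordinal.{u}} (hH : SmallSet μ H) :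
    ∃ i₀ < μ.ord, ∀ i < μ.ord, i₀ ≤ i → Disjoint (x i) H := by
  have h1 : ∀ i, ∃ y, ¬ Disjoint (x i) H → y ∈ x i ∧ y ∈ H := by
    intro i
    by_cases h : Disjoint (x i) H
    · exact ⟨0, fun h' ↦ absurd h h'⟩
    · obtain ⟨y, hy⟩ := not_disjoint_iff.1 h
      exact ⟨y, fun _ ↦ hy⟩
  choose y hy using h1
  have h2 : SmallSet μ {i | i < μ.ord ∧ ¬ Disjoint (x i) H} := by
    refine hH.of_injOn (f := y) (fun i hi j hj hij ↦ ?_) fun i hi ↦ (hy i hi.2).2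
    rcases lt_trichotomy i j with h | h | h
    · exact absurd (hij ▸ (hy i hi.2).1) (disjoint_right.1 (hx.2 i j h hj.1) (hy j hj.2).1)
    · exact h
    · exact absurd (hij ▸ (hy j hj.2).1) (disjoint_right.1 (hx.2 j i h hi.1) (hy i hi.2).1)
  obtain ⟨b, hb, hb'⟩ := h2.exists_lt_ord hμ fun i hi ↦ hi.1
  refine ⟨b, hb, fun i hi hbi ↦ ?_⟩
  by_contra h
  exact (hb' i ⟨hi, h⟩).not_ge hbi

/-- A request at a stage of the construction of the colouring: to use the blocks of `γ` for the
value `p`, or to keep free those of them that earlier stages use or avoid as prescribed. -/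
abbrev Request := Ordinal.{u} × (Ordinal.{u} × Ordinal.{u}) × Option (Ordinal.{u} × List Ordinal.{u})

/-- A family of partial functions, the stages of a colouring. -/
abbrev Stages := Ordinal.{u} → Ordinal.{u} → Option (Ordinal.{u} × Ordinal.{u})

/-- The indices of the blocks on which stage `η` has value `p` and the stages in `B` are
undefined. -/
def freeIndices (μ : Cardinal.{u}) (c : Stages.{u}) (x : Ordinal.{u} → Set Ordinal.{u})
    (p : Ordinal.{u} × Ordinal.{u}) (η : Ordinal.{u}) (B : Set Ordinal.{u}) : Set Ordinal.{u} :=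
  {j | j < μ.ord ∧ (∀ α ∈ x j, c η α = some p) ∧ ∀ ζ ∈ B, ∀ α ∈ x j, c ζ α = none}

/-- The blocks of a request. -/
noncomputable def requestBlock (μ : Cardinal.{u}) (blk : Ordinal.{u} → Ordinal.{u} → Set Ordinal.{u})
    (c : Stages.{u}) : Request.{u} → Ordinal.{u} → Set Ordinal.{u}
  | (γ, _, none), i => blk γ i
  | (γ, p, some (η, B)), i => blk γ (sInf {j | j ∈ freeIndices μ c (blk γ) p η {x | x ∈ B} ∧ i ≤ j})

/-- The requests treated at stage `ζ`. -/
def requests (μ : Cardinal.{u}) (blk : Ordinal.{u} → Ordinal.{u} → Set Ordinal.{u})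
    (c : Stages.{u}) (ζ : Ordinal.{u}) : Set Request.{u} :=
  {s | s.1 < ζ ∧ IsBlockSeq μ (blk s.1) ∧ s.2.1.1 < s.2.1.2 ∧ s.2.1.2 ≤ ζ ∧
    (∀ i < μ.ord, ∀ α ∈ blk s.1 i, s.2.1.1 ≤ α ∧ α < s.2.1.2) ∧
    (∀ q, s.2.2 = some q → q.1 < ζ ∧ ∀ x ∈ q.2, x < ζ) ∧
    ∀ H, SmallSet μ H → ∀ i₀ < μ.ord, ∃ i < μ.ord, i₀ ≤ i ∧ Disjoint (requestBlock μ blk c s i) H}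

/-- Reservations list only finitely many stages: there are at most `μ` such lists below `ζ`, whereas
the small subsets of `ζ` may be too many. -/
theorem small_requests (hμ : μ.IsRegular) (blk : Ordinal.{u} → Ordinal.{u} → Set Ordinal.{u})
    (c : Stages.{u}) {ζ : Ordinal.{u}} (hζ : ζ < (Order.succ μ).ord) :
    SmallSet (Order.succ μ) (requests μ blk c ζ) := by
  have hκ := (succ_regular hμ).aleph0_le
  have hω : ℵ₀ < Order.succ μ := hμ.aleph0_le.trans_lt (Order.lt_succ μ)
  have h1 : SmallSet (Order.succ μ) (Iic ζ) := .Iic hκ hζ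
  have h2 : SmallSet (Order.succ μ) (Iio ζ) := SmallSet.Iio_iff.2 hζ
  have h3 := ((h2.prod hκ (small_lists hω h2)).image some).union hκ
    (.of_finite hκ (finite_singleton none))
  refine (h2.prod hκ ((h1.prod hκ h1).prod hκ h3)).mono ?_
  rintro ⟨γ, ⟨p, q⟩, r⟩ ⟨hγ, -, hpq, hq, -, hr, -⟩
  refine ⟨hγ, ⟨hpq.le.trans hq, hq⟩, ?_⟩
  cases r with
  | none => exact Or.inr rfl
  | some x => exact Or.inl ⟨x, hr x rfl, rfl⟩

/-- The stage `n` at `ζ` treats all requests, given the earlier stages `c`. -/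
def IsNextStage (μ : Cardinal.{u}) (blk : Ordinal.{u} → Ordinal.{u} → Set Ordinal.{u})
    (c : Stages.{u}) (ζ : Ordinal.{u})
    (n : Ordinal.{u} → Option (Ordinal.{u} × Ordinal.{u})) : Prop :=
  (∀ α p, n α = some p → p.1 ≤ α ∧ α < p.2 ∧ p.2 ≤ ζ) ∧
  (ζ < (Order.succ μ).ord → ∃ y : Ordinal.{u} → Set Ordinal.{u}, (∀ k < μ.ord, SmallSet μ (y k)) ∧
    (∀ s ∈ requests μ blk c ζ, ∀ i₀ < μ.ord, ∃ i < μ.ord, i₀ ≤ i ∧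
      (s.2.2 = none → ∀ α ∈ requestBlock μ blk c s i, n α = some s.2.1) ∧
      (s.2.2 ≠ none → ∀ α ∈ requestBlock μ blk c s i, n α = none)) ∧
    (∀ s ∈ requests μ blk c ζ, ∃ k₀ < μ.ord, ∀ k < μ.ord, k₀ ≤ k → ∀ i ≤ k,
      Disjoint (y k) (requestBlock μ blk c s i)) ∧
    ∀ α, n α ≠ none → ∃ k < μ.ord, α ∈ y k)

theorem requestBlock_small (hμ : μ.IsRegular)
    {blk : Ordinal.{u} → Ordinal.{u} → Set Ordinal.{u}}
    (c : Stages.{u}) {s : Request.{u}} (hs : IsBlockSeq μ (blk s.1)) {i : Ordinal.{u}}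
    (hi : i < μ.ord) : SmallSet μ (requestBlock μ blk c s i) := by
  rcases s with ⟨γ, p, _ | ⟨η, B⟩⟩
  · exact hs.1 i hi
  · refine hs.1 _ ?_
    -- With no free index left, the infimum takes its default value `0`, which is still below `μ`.
    rcases eq_empty_or_nonempty
      {j | j ∈ freeIndices μ c (blk γ) p η {x | x ∈ B} ∧ i ≤ j} with h | h
    · rw [h, Ordinal.sInf_empty]
      exact hμ.ord_pos
    · exact (csInf_mem h).1.1

/-- Among the disjoint blocks picked by `exists_stage`, those picked for a use receive its value;
those picked for a reservation, and all points outside the blocks, stay undefined. -/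
theorem exists_nextStage (hμ : μ.IsRegular) (blk : Ordinal.{u} → Ordinal.{u} → Set Ordinal.{u})
    (c : Stages.{u}) (ζ : Ordinal.{u}) : ∃ n, IsNextStage μ blk c ζ n := by
  classical
  by_cases hζ : ζ < (Order.succ μ).ord
  swap
  · exact ⟨fun _ ↦ none, fun α p h ↦ by simp at h, fun h ↦ absurd h hζ⟩
  rcases (requests μ blk c ζ).eq_empty_or_nonempty with he | hne
  · refine ⟨fun _ ↦ none, fun α p h ↦ by simp at h, fun _ ↦ ⟨fun _ ↦ ∅, fun k _ ↦
      .of_finite hμ.aleph0_le finite_empty, ?_, ?_, fun α h ↦ absurd rfl h⟩⟩ <;>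
    simp [he]
  have : Nonempty (requests μ blk c ζ) := hne.to_subtype
  obtain ⟨tk, idx, h1, h2, h3, h4⟩ := exists_stage hμ (τ := requests μ blk c ζ)
    (smallSet_succ_iff.1 (small_requests hμ blk c hζ)) (fun s ↦ requestBlock μ blk c s)
    (fun s i hi ↦ requestBlock_small hμ c s.2.2.1 hi)
    (fun s H hH i₀ hi₀ ↦ s.2.2.2.2.2.2.2 H hH i₀ hi₀)
  let y : Ordinal.{u} → Set Ordinal.{u} := fun k ↦ requestBlock μ blk c (tk k) (idx k)
  have huniq : ∀ j < μ.ord, ∀ k < μ.ord, ∀ α ∈ y j, α ∈ y k → j = k := by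
    intro j hj k hk α hαj hαk
    rcases lt_trichotomy j k with h | h | h
    · exact absurd hαj (disjoint_left.1 (h2 j k h hk) hαk)
    · exact h
    · exact absurd hαk (disjoint_left.1 (h2 k j h hj) hαj)
  let P : Ordinal.{u} → Ordinal.{u} → Prop :=
    fun α k ↦ k < μ.ord ∧ α ∈ y k ∧ (tk k).1.2.2 = none
  let n : Ordinal.{u} → Option (Ordinal.{u} × Ordinal.{u}) :=
    fun α ↦ if h : ∃ k, P α k then some (tk h.choose).1.2.1 else none
  have hn : ∀ α p, n α = some p → ∃ k, P α k ∧ (tk k).1.2.1 = p := by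
    intro α p h
    by_cases hex : ∃ k, P α k
    · simp only [n, dif_pos hex, Option.some.injEq] at h
      exact ⟨_, hex.choose_spec, h⟩
    · simp [n, dif_neg hex] at h
  refine ⟨n, fun α p h ↦ ?_, fun _ ↦ ⟨y, fun k hk ↦ ?_, fun s hs i₀ hi₀ ↦ ?_, fun s hs ↦ ?_,
    fun α hα ↦ ?_⟩⟩
  · obtain ⟨k, ⟨hk, hαk, hnone⟩, rfl⟩ := hn α p h
    obtain ⟨-, -, -, hζ', hbd, -⟩ := (tk k).2
    have : y k = blk (tk k).1.1 (idx k) := by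
      simp only [y]
      rcases htk : (tk k).1 with ⟨γ, p, r⟩
      rw [htk] at hnone
      cases hnone
      rfl
    rw [this] at hαk
    exact ⟨(hbd _ (h1 k hk) α hαk).1, (hbd _ (h1 k hk) α hαk).2, hζ'⟩
  · exact requestBlock_small hμ c (tk k).2.2.1 (h1 k hk)
  · obtain ⟨k, hk, hks, hik⟩ := h3 ⟨s, hs⟩ i₀ hi₀
    have hyk : requestBlock μ blk c s (idx k) = y k := by simp [y, hks]
    refine ⟨idx k, h1 k hk, hik, fun hnone α hα ↦ ?_, fun hsome α hα ↦ ?_⟩ <;> rw [hyk] at hα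
    · have hex : ∃ k, P α k := ⟨k, hk, hα, by rw [hks]; exact hnone⟩
      have hk' : hex.choose = k :=
        huniq _ hex.choose_spec.1 k hk α hex.choose_spec.2.1 hα
      simp only [n, dif_pos hex, hk', hks]
    · by_contra h
      obtain ⟨p, hp⟩ := Option.ne_none_iff_exists'.1 h
      obtain ⟨k', ⟨hk'1, hk'2, hk'3⟩, -⟩ := hn α p hp
      rw [huniq k' hk'1 k hk α hk'2 hα, hks] at hk'3
      exact hsome hk'3
  · exact h4 ⟨s, hs⟩
  · obtain ⟨p, hp⟩ := Option.ne_none_iff_exists'.1 hα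
    obtain ⟨k, hk, -⟩ := hn α p hp
    exact ⟨k, hk.1, hk.2.1⟩

open Classical in
/-- The stages of `c` below `ζ`. -/
noncomputable def Stages.below (c : Stages.{u}) (ζ : Ordinal.{u}) : Stages.{u} :=
  fun η ↦ if η < ζ then c η else fun _ ↦ none

theorem freeIndices_below {c : Stages.{u}} {x : Ordinal.{u} → Set Ordinal.{u}}
    {p : Ordinal.{u} × Ordinal.{u}} {η ζ : Ordinal.{u}} {B : Set Ordinal.{u}} (hη : η < ζ)
    (hB : ∀ y ∈ B, y < ζ) :
    freeIndices μ (c.below ζ) x p η B = freeIndices μ c x p η B := by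
  ext j
  simp only [freeIndices, Stages.below, if_pos hη, mem_ofPred_eq]
  refine and_congr_right fun _ ↦ and_congr_right fun _ ↦ forall₂_congr fun y hy ↦ ?_
  rw [if_pos (hB y hy)]

theorem exists_stages (hμ : μ.IsRegular) (blk : Ordinal.{u} → Ordinal.{u} → Set Ordinal.{u}) :
    ∃ c : Stages.{u}, ∀ ζ, IsNextStage μ blk (c.below ζ) ζ (c ζ) := by
  classical
  choose F hF using exists_nextStage hμ blk
  let c : Stages.{u} := WellFounded.fix
    (C := fun _ ↦ Ordinal.{u} → Option (Ordinal.{u} × Ordinal.{u})) Ordinal.lt_wf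
    fun ζ r ↦ F (fun η ↦ if h : η < ζ then r η h else fun _ ↦ none) ζ
  have hc : ∀ ζ, c ζ = F (c.below ζ) ζ := fun ζ ↦ by
    simp only [c]
    rw [WellFounded.fix_eq]
    rfl
  refine ⟨c, fun ζ ↦ ?_⟩
  have := hF (c.below ζ) ζ
  rwa [← hc] at this

section Colouring

variable {blk : Ordinal.{u} → Ordinal.{u} → Set Ordinal.{u}} {c : Stages.{u}}
  {γ η ζ : Ordinal.{u}} {p : Ordinal.{u} × Ordinal.{u}}

theorem use_mem_requests (hμ : μ.IsRegular) (hx : IsBlockSeq μ (blk γ)) (hγ : γ < ζ)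
    (hp : p.1 < p.2) (hpζ : p.2 ≤ ζ) (hb : ∀ i < μ.ord, ∀ α ∈ blk γ i, p.1 ≤ α ∧ α < p.2) :
    (γ, p, none) ∈ requests μ blk c ζ := by
  refine ⟨hγ, hx, hp, hpζ, hb, fun q hq ↦ by simp at hq, fun H hH i₀ hi₀ ↦ ?_⟩
  obtain ⟨i₁, hi₁, h⟩ := hx.exists_disjoint_tail hμ hH
  exact ⟨max i₀ i₁, max_lt hi₀ hi₁, le_max_left _ _, h _ (max_lt hi₀ hi₁) (le_max_right _ _)⟩

theorem reserve_spec {B : List Ordinal.{u}}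
    (hf : ∀ i < μ.ord, ∃ j ∈ freeIndices μ c (blk γ) p η {x | x ∈ B}, i ≤ j) {i : Ordinal.{u}}
    (hi : i < μ.ord) : ∃ j ∈ freeIndices μ c (blk γ) p η {x | x ∈ B}, i ≤ j ∧
      requestBlock μ blk c (γ, p, some (η, B)) i = blk γ j := by
  obtain ⟨j, hj, hij⟩ := hf i hi
  have := csInf_mem (s := {j | j ∈ freeIndices μ c (blk γ) p η {x | x ∈ B} ∧ i ≤ j}) ⟨j, hj, hij⟩
  exact ⟨_, this.1, this.2, rfl⟩

theorem reserve_mem_requests (hμ : μ.IsRegular) (hx : IsBlockSeq μ (blk γ)) (hγ : γ < ζ)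
    (hp : p.1 < p.2) (hpζ : p.2 ≤ ζ) (hb : ∀ i < μ.ord, ∀ α ∈ blk γ i, p.1 ≤ α ∧ α < p.2)
    {B : List Ordinal.{u}} (hη : η < ζ) (hB : ∀ x ∈ B, x < ζ)
    (hf : ∀ i < μ.ord, ∃ j ∈ freeIndices μ c (blk γ) p η {x | x ∈ B}, i ≤ j) :
    (γ, p, some (η, B)) ∈ requests μ blk c ζ := by
  refine ⟨hγ, hx, hp, hpζ, hb, fun q hq ↦ ?_, fun H hH i₀ hi₀ ↦ ?_⟩
  · cases hq
    exact ⟨hη, hB⟩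
  · obtain ⟨i₁, hi₁, h⟩ := hx.exists_disjoint_tail hμ hH
    refine ⟨max i₀ i₁, max_lt hi₀ hi₁, le_max_left _ _, ?_⟩
    obtain ⟨j, hj, hij, hblk⟩ := reserve_spec hf (max_lt hi₀ hi₁)
    rw [hblk]
    exact h j hj.1 ((le_max_right _ _).trans hij)

variable (hμ : μ.IsRegular) (hc : ∀ ζ, IsNextStage μ blk (c.below ζ) ζ (c ζ))
  (hx : IsBlockSeq μ (blk γ)) (hγ : γ < η) (hp : p.1 < p.2) (hpη : p.2 ≤ η)
  (hb : ∀ i < μ.ord, ∀ α ∈ blk γ i, p.1 ≤ α ∧ α < p.2)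

include hμ hc hx hγ hp hpη hb

theorem freeIndices_empty_unbounded (hη : η < (Order.succ μ).ord) :
    ∀ i < μ.ord, ∃ j ∈ freeIndices μ c (blk γ) p η ∅, i ≤ j := by
  intro i hi
  obtain ⟨y, -, h, -⟩ := (hc η).2 hη
  obtain ⟨j, hj, hij, h1, -⟩ := h _ (use_mem_requests hμ hx hγ hp hpη hb) i hi
  exact ⟨j, ⟨hj, h1 rfl, by simp⟩, hij⟩

/-- Induction on the largest stage `ζ` of `T`: the blocks free for the smaller stages form a
reservation at `ζ`, which leaves unboundedly many of them undefined. -/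
theorem freeIndices_finset_unbounded (hη : η < (Order.succ μ).ord) (T : Finset Ordinal.{u})
    (hT : ∀ ζ ∈ T, η < ζ ∧ ζ < (Order.succ μ).ord) :
    ∀ i < μ.ord, ∃ j ∈ freeIndices μ c (blk γ) p η T, i ≤ j := by
  induction T using Finset.induction_on_max with
  | empty => simpa using freeIndices_empty_unbounded hμ hc hx hγ hp hpη hb hη
  | insert ζ T hmax ih =>
    intro i hi
    have ih' := ih fun ζ' hζ' ↦ hT ζ' (Finset.mem_insert_of_mem hζ')
    obtain ⟨hηζ, hζ⟩ := hT ζ (Finset.mem_insert_self _ _)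
    obtain ⟨y, -, h, -⟩ := (hc ζ).2 hζ
    have hset : {x | x ∈ T.toList} = (T : Set Ordinal.{u}) := by ext; simp
    have hf : ∀ i < μ.ord, ∃ j ∈ freeIndices μ (c.below ζ) (blk γ) p η {x | x ∈ T.toList},
        i ≤ j := by
      rw [hset, freeIndices_below hηζ hmax]
      exact ih'
    obtain ⟨i', hi', hii', -, h2⟩ := h _ (reserve_mem_requests hμ hx (hγ.trans hηζ) hp
      (hpη.trans hηζ.le) hb hηζ (fun x hx ↦ hmax x (by simpa using hx)) hf) i hi
    obtain ⟨j, hj, hij, hblk⟩ := reserve_spec hf hi'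
    rw [hset, freeIndices_below hηζ hmax] at hj
    rw [hblk] at h2
    refine ⟨j, ⟨hj.1, hj.2.1, fun ζ' hζ' ↦ ?_⟩, hii'.trans hij⟩
    rcases Finset.mem_insert.1 (Finset.mem_coe.1 hζ') with rfl | h3
    · exact h2 (by simp)
    · exact hj.2.2 ζ' h3

/-- For `μ = ℵ₀` the set `T` is finite. For uncountable `μ` the induction over `T` is replaced by a
closure argument, using the reservation with empty list at each stage of `T` together with the late
avoidance of `exists_stage`. -/
theorem freeIndices_nonempty (hη : η < (Order.succ μ).ord) {T : Set Ordinal.{u}}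
    (hTs : SmallSet μ T) (hT : ∀ ζ ∈ T, η < ζ ∧ ζ < (Order.succ μ).ord) :
    (freeIndices μ c (blk γ) p η T).Nonempty := by
  rcases hμ.aleph0_le.eq_or_lt with h0 | hω
  · have hfin : T.Finite := by
      rw [SmallSet, ← h0, lift_aleph0] at hTs
      exact lt_aleph0_iff_set_finite.1 hTs
    lift T to Finset Ordinal.{u} using hfin
    obtain ⟨j, hj, -⟩ := freeIndices_finset_unbounded hμ hc hx hγ hp hpη hb hη T hT 0 hμ.ord_pos
    exact ⟨j, hj⟩
  · have h1 : ∀ ζ, ∃ y : Ordinal.{u} → Set Ordinal.{u}, ∃ k₀, ζ ∈ T →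
        (∀ k < μ.ord, SmallSet μ (y k)) ∧ k₀ < μ.ord ∧
        (∀ k < μ.ord, k₀ ≤ k → ∀ i ≤ k, Disjoint (y k)
          (requestBlock μ blk c (γ, p, some (η, [])) i)) ∧
        ∀ α, c ζ α ≠ none → ∃ k < μ.ord, α ∈ y k := by
      intro ζ
      by_cases hζT : ζ ∈ T
      swap
      · exact ⟨fun _ ↦ ∅, 0, fun h ↦ absurd h hζT⟩
      obtain ⟨hηζ, hζ⟩ := hT ζ hζT
      obtain ⟨y, hy, -, h2, h3⟩ := (hc ζ).2 hζ
      have hset : {x : Ordinal.{u} | x ∈ ([] : List Ordinal.{u})} = ∅ := by ext; simp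
      have heq : freeIndices μ (c.below ζ) (blk γ) p η {x | x ∈ ([] : List Ordinal.{u})} =
          freeIndices μ c (blk γ) p η {x | x ∈ ([] : List Ordinal.{u})} :=
        freeIndices_below hηζ (by simp)
      obtain ⟨k₀, hk₀, h4⟩ := h2 _ (reserve_mem_requests hμ hx (hγ.trans hηζ) hp
        (hpη.trans hηζ.le) hb hηζ (B := []) (by simp) (by
          rw [heq, hset]
          exact freeIndices_empty_unbounded hμ hc hx hγ hp hpη hb hη))
      refine ⟨y, k₀, fun _ ↦ ⟨hy, hk₀, fun k hk hkk i hi ↦ ?_, h3⟩⟩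
      have := h4 k hk hkk i hi
      rwa [requestBlock, heq] at this
    choose y k₀ hyk using h1
    obtain ⟨j₀, hj₀, hkj⟩ := (hTs.image k₀).exists_lt_ord hμ (by
      rintro _ ⟨ζ, hζ, rfl⟩
      exact (hyk ζ hζ).2.1)
    have h2 : ∀ j, ∃ j', j < μ.ord → j' < μ.ord ∧
        ∀ i < μ.ord, j' ≤ i → ∀ ζ ∈ T, ∀ k ≤ j, Disjoint (blk γ i) (y ζ k) := by
      intro j
      by_cases hj : j < μ.ord
      · obtain ⟨i₀, hi₀, h⟩ := hx.exists_disjoint_tail hμ (H := ⋃ ζ ∈ T, ⋃ k ∈ Iic j, y ζ k)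
          (.biUnion hμ hTs fun ζ hζ ↦ .biUnion hμ (.Iic hμ.aleph0_le hj) fun k hk ↦
            (hyk ζ hζ).1 k (lt_of_le_of_lt hk hj))
        refine ⟨i₀, fun _ ↦ ⟨hi₀, fun i hi hii ζ hζ k hk ↦ (h i hi hii).mono_right fun z hz ↦ ?_⟩⟩
        simp only [mem_iUnion, exists_prop]
        exact ⟨ζ, hζ, k, hk, hz⟩
      · exact ⟨0, fun h ↦ absurd h hj⟩
    choose nx hnx using h2
    -- From index `nx j` on, the blocks of `γ` miss what any stage of `T` picked up to step `j`.
    -- Iterating `ω` times gives a closure point below `μ`, as `μ` is regular and uncountable.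
    let s : ℕ → Ordinal.{u} := fun m ↦ Nat.rec j₀ (fun _ j ↦ nx j) m
    have hs : ∀ m, s m < μ.ord := by
      intro m
      induction m with
      | zero => exact hj₀
      | succ m ih => exact (hnx _ ih).1
    have hjω : ⨆ m, s m < μ.ord := by
      refine lift_iSup_lt_of_lt_cof ?_ hs
      simpa [hμ.cof_ord, ← lift_cof] using hω
    have hle : ∀ m, s m ≤ ⨆ m, s m := fun m ↦ Ordinal.le_iSup s m
    have hset : {x : Ordinal.{u} | x ∈ ([] : List Ordinal.{u})} = ∅ := by ext; simp
    obtain ⟨j, hj, hij, hblk⟩ := reserve_spec (B := []) (by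
      rw [hset]
      exact freeIndices_empty_unbounded hμ hc hx hγ hp hpη hb hη) hjω
    refine ⟨j, hj.1, hj.2.1, fun ζ hζ α hα ↦ ?_⟩
    by_contra hne
    obtain ⟨-, -, h3, h4⟩ := hyk ζ hζ
    obtain ⟨k, hk, hαk⟩ := h4 α hne
    -- Picks made before the closure point are missed because the index `j` is large; later picks
    -- miss the block by late avoidance, since it is the reserved block with index equal to the
    -- closure point.
    rcases lt_or_ge k (⨆ m, s m) with h | h
    · obtain ⟨m, hm⟩ := Ordinal.lt_iSup_iff.1 h
      exact disjoint_left.1 ((hnx _ (hs m)).2 j hj.1 ((hle (m + 1)).trans hij) ζ hζ k hm.le) hα hαk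
    · have h5 := h3 k hk ((hkj _ ⟨ζ, hζ, rfl⟩).le.trans ((hle 0).trans h)) _ h
      rw [hblk] at h5
      exact disjoint_left.1 h5 hαk hα

end Colouring

theorem exists_colouring (hμ : μ.IsRegular)
    (blk : Ordinal.{u} → Ordinal.{u} → Set Ordinal.{u}) :
    ∃ c : Stages.{u}, (∀ ζ α p, c ζ α = some p → p.1 ≤ α ∧ α < p.2 ∧ p.2 ≤ ζ) ∧
      ∀ γ η p, IsBlockSeq μ (blk γ) → γ < η → η < (Order.succ μ).ord → p.1 < p.2 → p.2 ≤ η →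
        (∀ i < μ.ord, ∀ α ∈ blk γ i, p.1 ≤ α ∧ α < p.2) → ∀ T, SmallSet μ T →
        (∀ ζ ∈ T, η < ζ ∧ ζ < (Order.succ μ).ord) → ∃ i < μ.ord,
          (∀ α ∈ blk γ i, c η α = some p) ∧ ∀ ζ ∈ T, ∀ α ∈ blk γ i, c ζ α = none := by
  obtain ⟨c, hc⟩ := exists_stages hμ blk
  refine ⟨c, fun ζ ↦ (hc ζ).1, fun γ η p hx hγ hη hp hpη hb T hTs hT ↦ ?_⟩
  exact freeIndices_nonempty hμ hc hx hγ hp hpη hb hη hTs hT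

/-! ### Uniform walks through points of cofinality `μ`, and the stick case -/

theorem exists_walk_append_of_small (hμ : μ.IsRegular) {C : Ordinal.{u} → Set Ordinal.{u}}
    {o η : Ordinal.{u}} (hC : ∀ ζ < o, IsCofinalIn ζ (C ζ)) (hη : η.cof = μ)
    (hb : ∀ ζ < o, η < ζ → BoundedBelow (C ζ) η) {b : Set Ordinal.{u}} (hbs : SmallSet μ b)
    (hbo : ∀ β ∈ b, η ≤ β ∧ β < o) :
    ∃ l < η, ∀ β ∈ b, ∀ α, l < α → α ≤ η → walk C α β = walk C η β ++ walk C α η := by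
  have hη0 : 0 < η := by
    rw [← Ordinal.cof_pos, hη]
    exact hμ.pos
  have h : ∀ β, ∃ l, β ∈ b → l < η ∧ ∀ α, l < α → α ≤ η →
      walk C α β = walk C η β ++ walk C α η := by
    intro β
    by_cases hβ : β ∈ b
    · obtain ⟨l, hl⟩ := exists_walk_append hC (hbo β hβ).2 hη0 (hbo β hβ).1 hb
      exact ⟨l, fun _ ↦ hl⟩
    · exact ⟨0, fun h ↦ absurd h hβ⟩
  choose l hl using h
  subst hη
  obtain ⟨m, hm, h⟩ := (hbs.image l).exists_lt (by
    rintro _ ⟨β, hβ, rfl⟩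
    exact (hl β hβ).1)
  exact ⟨m, hm, fun β hβ α hα ↦ (hl β hβ).2 α ((h _ ⟨β, hβ, rfl⟩).trans hα)⟩

theorem exists_unbounded_walk_append (hμ : μ.IsRegular) {C : Ordinal.{u} → Set Ordinal.{u}}
    (hC : ∀ ζ < (Order.succ μ).ord, IsCofinalIn ζ (C ζ))
    (hb : ∀ ζ < (Order.succ μ).ord, ∀ x < ζ, x.cof = μ → BoundedBelow (C ζ) x)
    {b : Ordinal.{u} → Set Ordinal.{u}} (hbs : ∀ η < (Order.succ μ).ord, SmallSet μ (b η))
    (hbo : ∀ η < (Order.succ μ).ord, ∀ β ∈ b η, η ≤ β ∧ β < (Order.succ μ).ord) :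
    ∃ l < (Order.succ μ).ord, ∀ ε < (Order.succ μ).ord,
      ∃ η < (Order.succ μ).ord, ε ≤ η ∧ η.cof = μ ∧
        ∀ β ∈ b η, ∀ α, l < α → α ≤ η → walk C α β = walk C η β ++ walk C α η := by
  have h : ∀ η, ∃ l, η < (Order.succ μ).ord → η.cof = μ → l < η ∧
      ∀ β ∈ b η, ∀ α, l < α → α ≤ η → walk C α β = walk C η β ++ walk C α η := by
    intro η
    by_cases hη : η < (Order.succ μ).ord ∧ η.cof = μ
    · obtain ⟨l, hl⟩ := exists_walk_append_of_small hμ hC hη.2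
        (fun ζ hζ hηζ ↦ hb ζ hζ η hηζ hη.2) (hbs η hη.1) (hbo η hη.1)
      exact ⟨l, fun _ _ ↦ hl⟩
    · exact ⟨0, fun h1 h2 ↦ absurd ⟨h1, h2⟩ hη⟩
  choose lam hlam using h
  obtain ⟨l, hl, h⟩ := exists_bound_unbounded hμ fun η h1 h2 ↦ (hlam η h1 h2).1
  refine ⟨l, hl, fun ε hε ↦ ?_⟩
  obtain ⟨η, hη, hεη, hc, hle⟩ := h ε hε
  exact ⟨η, hη, hεη, hc, fun β hβ α hα ↦ (hlam η hη hc).2 β hβ α (hle.trans_lt hα)⟩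

theorem IsDisjointFamily.lt {κ : Cardinal.{u}} {σ : Ordinal.{u}}
    {𝒜 : Set (Set Ordinal.{u})} (h : IsDisjointFamily κ σ 𝒜) {a : Set Ordinal.{u}} (ha : a ∈ 𝒜)
    {α : Ordinal.{u}} (hα : α ∈ a) : α < κ.ord :=
  (h.1 ha).1 hα

theorem IsDisjointFamily.exists_selection {κ : Cardinal.{u}} {σ : Ordinal.{u}}
    {𝒜 : Set (Set Ordinal.{u})} (h : IsDisjointFamily κ σ 𝒜) :
    ∃ f : Ordinal.{u} → Set Ordinal.{u}, ∀ ε < κ.ord, f ε ∈ 𝒜 ∧ ∀ α ∈ f ε, ε ≤ α ∧ α < κ.ord := by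
  have h1 : ∀ ε, ∃ a, ε < κ.ord → a ∈ 𝒜 ∧ ∀ α ∈ a, ε ≤ α ∧ α < κ.ord := by
    intro ε
    by_cases hε : ε < κ.ord
    · obtain ⟨a, ha, h2⟩ := h.exists_above hε
      exact ⟨a, fun _ ↦ ⟨ha, fun α hα ↦ ⟨h2 α hα, h.lt ha hα⟩⟩⟩
    · exact ⟨∅, fun h ↦ absurd h hε⟩
  choose f hf using h1
  exact ⟨f, hf⟩

theorem image2_eq_singleton {α β γ : Type*} {f : α → β → γ} {a : Set α} {b : Set β} {p : γ}
    (ha : a.Nonempty) (hb : b.Nonempty) (h : ∀ x ∈ a, ∀ y ∈ b, f x y = p) :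
    image2 f a b = {p} := by
  refine Subset.antisymm (image2_subset_iff.2 fun x hx y hy ↦ h x hx y hy) ?_
  obtain ⟨x, hx⟩ := ha
  obtain ⟨y, hy⟩ := hb
  exact singleton_subset_iff.2 ⟨x, hx, y, hy, h x hx y hy⟩

theorem exists_injOn_of_hasOtp {c : Cardinal.{u}} {X : Set Ordinal.{u}} (h : HasOtp X c.ord) :
    ∃ x : Ordinal.{u} → Ordinal.{u}, InjOn x (Iio c.ord) ∧ MapsTo x (Iio c.ord) X := by
  classical
  have h1 : #(Iio c.ord) = #X := by
    have := congrArg Ordinal.card h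
    rw [card_type, ← lift_card, card_ord] at this
    rw [this, Cardinal.mk_Iio_ordinal, card_ord]
  obtain ⟨f⟩ := Cardinal.eq.1 h1
  refine ⟨fun i ↦ if hi : i < c.ord then f ⟨i, hi⟩ else 0, fun i hi j hj hij ↦ ?_, fun i hi ↦ ?_⟩
  · rw [mem_Iio] at hi hj
    simp only [hi, hj, dite_true] at hij
    exact Subtype.mk.inj (f.injective (Subtype.ext hij))
  · rw [mem_Iio] at hi
    simp only [hi, dite_true]
    exact (f _).2

theorem small_walk (hμ : μ.IsRegular) {C : Ordinal.{u} → Set Ordinal.{u}} {η : Ordinal.{u}}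
    {b : Set Ordinal.{u}} (hb : SmallSet μ b) :
    SmallSet μ (⋃ β ∈ b, {ζ | ∃ q ∈ walk C η β, q.1 = ζ}) := by
  refine .biUnion hμ hb fun β _ ↦ .of_finite hμ.aleph0_le ?_
  refine ((walk C η β).map Prod.fst).finite_toSet.subset ?_
  rintro _ ⟨q, hq, rfl⟩
  exact List.mem_map_of_mem hq

/-- The first value that the stages along a walk define. -/
noncomputable def walkColour (C : Ordinal.{u} → Set Ordinal.{u}) (c : Stages.{u})
    (α β : Ordinal.{u}) : Ordinal.{u} × Ordinal.{u} :=
  ((walk C α β).findSome? fun q ↦ c q.1 α).getD (α, β)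

theorem walkColour_spec {C : Ordinal.{u} → Set Ordinal.{u}} {c : Stages.{u}} {o α β : Ordinal.{u}}
    (hC : ∀ ζ < o, IsCofinalIn ζ (C ζ))
    (hc : ∀ ζ α p, c ζ α = some p → p.1 ≤ α ∧ α < p.2 ∧ p.2 ≤ ζ) (hαβ : α < β) (hβ : β < o) :
    (walkColour C c α β).1 ≤ α ∧ α < (walkColour C c α β).2 ∧ (walkColour C c α β).2 ≤ β := by
  rw [walkColour]
  rcases h : (walk C α β).findSome? fun q ↦ c q.1 α with _ | p
  · rw [h]
    exact ⟨le_rfl, hαβ, le_rfl⟩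
  · rw [h]
    obtain ⟨q, hq, hqp⟩ := List.exists_of_findSome?_eq_some h
    obtain ⟨h1, h2, h3⟩ := hc _ _ _ hqp
    exact ⟨h1, h2, h3.trans (mem_walk hC hβ hq).2.1⟩

theorem walkColour_eq {C : Ordinal.{u} → Set Ordinal.{u}} {c : Stages.{u}}
    {o α η β : Ordinal.{u}} {p : Ordinal.{u} × Ordinal.{u}}
    (hC : ∀ ζ < o, IsCofinalIn ζ (C ζ)) (hη : η < o) (hαη : α < η)
    (hw : walk C α β = walk C η β ++ walk C α η)
    (h1 : c η α = some p) (h2 : ∀ q ∈ walk C η β, c q.1 α = none) :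
    walkColour C c α β = p := by
  rw [walkColour, hw, List.findSome?_append, List.findSome?_eq_none_iff.2 h2,
    walk_of_lt (hC η hη) hαη, List.findSome?_cons]
  simp [h1]

theorem PL2_of_stick (hμ : μ.IsRegular) (hst : Stick μ) :
    PL2 (Order.succ μ) (Iio (Order.succ μ).ord) μ := by
  obtain ⟨X, hX⟩ := hst
  obtain ⟨K, hK, hK'⟩ := exists_blocks hμ
  have hκ := succ_regular hμ
  have hx : ∀ γ, ∃ x : Ordinal.{u} → Ordinal.{u}, HasOtp (X γ) μ.ord →
      InjOn x (Iio μ.ord) ∧ MapsTo x (Iio μ.ord) (X γ) := by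
    intro γ
    by_cases h : HasOtp (X γ) μ.ord
    · obtain ⟨x, hx⟩ := exists_injOn_of_hasOtp h
      exact ⟨x, fun _ ↦ hx⟩
    · exact ⟨id, fun h' ↦ absurd h' h⟩
  choose x hx using hx
  obtain ⟨c, hc, hc'⟩ := exists_colouring hμ fun γ i ↦ K (x γ i)
  obtain ⟨C, hC⟩ := exists_ladder hμ (S := ∅) (by
    intro α hα hcof hs
    obtain ⟨y, hy⟩ := hs.nonempty
    exact hy)
  have hCc : ∀ ζ < (Order.succ μ).ord, IsCofinalIn ζ (C ζ) := fun ζ hζ ↦ (hC ζ hζ).1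
  refine ⟨subset_rfl, ?_, walkColour C c, fun α β ↦ walkColour_spec hCc hc, fun σ hσ 𝒜 h𝒜 ↦ ?_⟩
  · exact IsStationary.mono (isStationaryIn_cofSet hμ) fun x hx ↦ hx.1
  obtain ⟨A, hA⟩ := h𝒜.exists_selection
  obtain ⟨l, hl, hl'⟩ := exists_unbounded_walk_append hμ hCc
    (fun ζ hζ x hx hcof ↦ (hC ζ hζ).2 x hx (Or.inl hcof)) (b := A)
    (fun η hη ↦ h𝒜.small hσ (hA η hη).1) fun η hη ↦ (hA η hη).2
  -- The ordinal `nx ε` codes a cover of `A ε` that stays at or above `ε`.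
  have hnx : ∀ ε, ∃ v, ε < (Order.succ μ).ord → ε < v ∧ v < (Order.succ μ).ord ∧ A ε ⊆ K v ∧
      ∀ α ∈ K v, ε ≤ α := by
    intro ε
    by_cases hε : ε < (Order.succ μ).ord
    · obtain ⟨hA1, hA2⟩ := hA ε hε
      obtain ⟨v, hv, hv'⟩ := hK' (A ε) (h𝒜.small hσ hA1) (fun α hα ↦ (hA2 α hα).2) ε hε
        (fun α hα ↦ (hA2 α hα).1) _ (lt_ord_succ_add_one hμ hε)
      exact ⟨v, fun _ ↦ ⟨(Order.lt_succ ε).trans_le hv, hv'⟩⟩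
    · exact ⟨0, fun h ↦ absurd h hε⟩
  choose nx hnx using hnx
  -- Only closure points `d` of `nx` are used, so that the covers coded by distinct elements of `Y
  -- ε` are disjoint: one ends before the next begins.
  let Y : Ordinal.{u} → Set Ordinal.{u} := fun ε ↦
    {v | ∃ d, d < (Order.succ μ).ord ∧ ε ≤ d ∧ (∀ ε' < d, nx ε' < d) ∧ nx d = v}
  have hYκ : ∀ ε, Y ε ⊆ Iio (Order.succ μ).ord := by
    rintro ε _ ⟨d, hd, -, -, rfl⟩
    exact (hnx d hd).2.1
  have hγ : ∀ ε, ∃ γ, ε < (Order.succ μ).ord → γ < (Order.succ μ).ord ∧ X γ ⊆ Y ε ∧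
      HasOtp (X γ) μ.ord := by
    intro ε
    by_cases hε : ε < (Order.succ μ).ord
    · obtain ⟨γ, hγ, h⟩ := hX (Y ε) ⟨hYκ ε, hasOtp_of_card (hYκ ε)
        (not_small_of_unbounded hκ (hYκ ε) fun ε' hε' ↦ by
          obtain ⟨d, hd, h1, -, h2⟩ := exists_closure_point hμ (fun x hx ↦ (hnx x hx).2.1)
            (max_lt hε hε')
          exact ⟨nx d, ⟨d, hd, (le_max_left _ _).trans h1.le, h2, rfl⟩,
            (le_max_right _ _).trans (h1.le.trans (hnx d hd).1.le)⟩)⟩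
      exact ⟨γ, fun _ ↦ ⟨hγ, h⟩⟩
    · exact ⟨0, fun h ↦ absurd h hε⟩
  choose γ hγ using hγ
  have hh : ∀ ε, ∃ h, ε < (Order.succ μ).ord → h < (Order.succ μ).ord ∧ γ ε < h ∧
      ∀ v ∈ X (γ ε), v < h := by
    intro ε
    by_cases hε : ε < (Order.succ μ).ord
    · obtain ⟨h1, h2, h3⟩ := hγ ε hε
      obtain ⟨b, hb, h4⟩ := exists_ord_succ_bound hμ
        (SmallSet.of_hasOtp h3 (ord_lt_ord_succ μ)) (f := id) fun v hv ↦ hYκ ε (h2 hv)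
      exact ⟨max b (Order.succ (γ ε)), fun _ ↦ ⟨max_lt hb (lt_ord_succ_add_one hμ h1),
        lt_max_of_lt_right (Order.lt_succ _), fun v hv ↦ lt_max_of_lt_left (h4 v hv)⟩⟩
    · exact ⟨0, fun h ↦ absurd h hε⟩
  choose h hh using hh
  -- For `α' < β'` in this club, `β'` exceeds `γ α'` and all of `X (γ α')`, so the coded blocks lie
  -- in `[α', β')`; `l < α'` sends the walks through `η`.
  refine ⟨_, isClubIn_closurePoints hμ (fun x hx ↦ (hh x hx).1) hl, ?_⟩
  rintro α' ⟨-, hα', hlα', -⟩ β' ⟨-, hβ', -, hβcl⟩ hαβ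
  obtain ⟨hγκ, hXY, hXotp⟩ := hγ α' hα'
  obtain ⟨-, hγh, hXh⟩ := hh α' hα'
  have hhβ := hβcl α' hαβ
  obtain ⟨hxinj, hxmaps⟩ := hx _ hXotp
  obtain ⟨η, hη, hβη, hηcof, hwalk⟩ := hl' β' hβ'
  have hdisj : ∀ v ∈ Y α', ∀ w ∈ Y α', w < v → Disjoint (K w) (K v) := by
    rintro _ ⟨d, hd, -, hdcl, rfl⟩ _ ⟨d', hd', -, hdcl', rfl⟩ hlt
    refine disjoint_left.2 fun z hz hz' ↦ ?_
    rcases lt_trichotomy d d' with h1 | rfl | h1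
    · exact (((hdcl' d h1).trans (hnx d' hd').1).trans hlt).false
    · exact hlt.false
    · exact (lt_of_lt_of_le ((hK _).2 hz) ((hdcl d' h1).le.trans ((hnx d hd).2.2.2 z hz'))).false
  have hseq : IsBlockSeq μ fun i ↦ K (x (γ α') i) := by
    refine ⟨fun i _ ↦ (hK _).1, fun i j hij hj ↦ ?_⟩
    have h1 := hXY (hxmaps (hij.trans hj : i ∈ Iio μ.ord))
    have h2 := hXY (hxmaps (hj : j ∈ Iio μ.ord))
    rcases lt_trichotomy (x (γ α') i) (x (γ α') j) with h3 | h3 | h3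
    · exact hdisj _ h2 _ h1 h3
    · exact absurd (hxinj (hij.trans hj : i ∈ Iio μ.ord) hj h3) hij.ne
    · exact (hdisj _ h1 _ h2 h3).symm
  obtain ⟨hAη, hAη'⟩ := hA η hη
  obtain ⟨i, hi, hi1, hi2⟩ := hc' (γ α') η (α', β') hseq ((hγh.trans hhβ).trans_le hβη) hη hαβ hβη
    (by
      intro i hi α hα
      have hv := hxmaps (hi : i ∈ Iio μ.ord)
      refine ⟨?_, lt_trans ((hK _).2 hα) ((hXh _ hv).trans hhβ)⟩
      obtain ⟨d, hd, hαd, -, hdv⟩ := hXY hv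
      rw [← hdv] at hα
      exact hαd.trans ((hnx d hd).2.2.2 α hα))
    _ (small_walk hμ (C := C) (η := η) (h𝒜.small hσ hAη)) (by
      intro ζ hζ
      simp only [mem_iUnion] at hζ
      obtain ⟨β, hβ, q, hq, rfl⟩ := hζ
      have h1 := mem_walk hCc (hAη' β hβ).2 hq
      exact ⟨h1.1, h1.2.1.trans_lt (hAη' β hβ).2⟩)
  obtain ⟨d, hd, hαd, hdcl, hdv⟩ := hXY (hxmaps (hi : i ∈ Iio μ.ord))
  obtain ⟨-, -, hsub, hge⟩ := hnx d hd
  have hlt : ∀ α ∈ A d, α < β' := fun α hα ↦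
    lt_trans ((hK _).2 (hsub hα)) (by rw [hdv]; exact (hXh _ (hxmaps hi)).trans hhβ)
  refine ⟨A d, (hA d hd).1, A η, hAη, fun α hα β hβ ↦ ?_, ?_⟩
  · exact (hlt α hα).trans_le (hβη.trans (hAη' β hβ).1)
  · refine image2_eq_singleton (h𝒜.nonempty hκ.aleph0_le (hA d hd).1)
      (h𝒜.nonempty hκ.aleph0_le hAη) fun α hα β hβ ↦ ?_
    have hαK : α ∈ K (x (γ α') i) := by
      rw [← hdv]
      exact hsub hα
    have hαη := (hlt α hα).trans_le hβη
    refine walkColour_eq hCc hη hαη (hwalk β hβ α ?_ hαη.le) (hi1 α hαK) fun q hq ↦ ?_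
    · exact hlα'.trans_le (hαd.trans ((hA d hd).2 α hα).1)
    · refine hi2 _ ?_ α hαK
      simp only [mem_iUnion]
      exact ⟨β, hβ, q, hq, rfl⟩

/-! ### Stick from `2 ^ μ = μ⁺`, and `pr₁` from `pl₂` -/

/-- Since `(μ⁺)^μ = μ⁺`, the sequence can list the ranges of all functions from `μ` to `μ⁺`. -/
theorem stick_of_two_power (hμ : μ.IsRegular) (h : 2 ^ μ = Order.succ μ) : Stick μ := by
  have hκ := succ_regular hμ
  have hpos : 0 < (Order.succ μ).ord := hκ.ord_pos
  have hpow : Order.succ μ ^ μ = Order.succ μ := by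
    rw [← h, ← power_mul, mul_eq_self hμ.aleph0_le]
  let F := Iio μ.ord → Iio (Order.succ μ).ord
  have : Nonempty F := ⟨fun _ ↦ ⟨0, hpos⟩⟩
  have hF : #F ≤ Cardinal.lift.{u + 1} (Order.succ μ) := by
    rw [← power_def, Cardinal.mk_Iio_ordinal, Cardinal.mk_Iio_ordinal, card_ord, card_ord,
      ← lift_power, hpow]
  obtain ⟨f, hf⟩ := exists_unbounded_fibers hκ.aleph0_le hF (not_small_Iio_ord _)
  refine ⟨fun γ ↦ range fun i ↦ (f γ i : Ordinal.{u}), fun Y hY ↦ ?_⟩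
  have hYs : ¬ SmallSet μ Y := by
    intro hs
    have h1 := congrArg Ordinal.card hY.2
    rw [card_type, ← lift_card, card_ord] at h1
    have h2 := hs.succ
    rw [SmallSet, h1] at h2
    exact h2.false
  obtain ⟨b, hbY, hb⟩ := exists_subset_hasOtp hYs
  have h1 : #(Iio μ.ord) = #b := by
    have := congrArg Ordinal.card hb
    rw [card_type, ← lift_card, card_ord] at this
    rw [this, Cardinal.mk_Iio_ordinal, card_ord]
  obtain ⟨φ⟩ := Cardinal.eq.1 h1
  obtain ⟨γ, hγ, -, hfγ⟩ := hf (fun i ↦ ⟨φ i, hY.1 (hbY (φ i).2)⟩) 0 hpos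
  refine ⟨γ, hγ, ?_⟩
  have h2 : (range fun i ↦ (f γ i : Ordinal.{u})) = b := by
    rw [hfγ]
    ext x
    refine ⟨?_, fun hx ↦ ⟨φ.symm ⟨x, hx⟩, by simp⟩⟩
    rintro ⟨i, rfl⟩
    exact (φ i).2
  simp only [h2]
  exact ⟨hbY, hb⟩

/-- The successor cardinal of `μ` splits into `μ⁺` sets meeting every club. -/
theorem exists_stationary_partition (hμ : μ.IsRegular) :
    ∃ h : Ordinal.{u} → Ordinal.{u}, (∀ β, h β < (Order.succ μ).ord) ∧
      ∀ τ < (Order.succ μ).ord, ∀ l < (Order.succ μ).ord, ∀ g : Ordinal.{u} → Ordinal.{u},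
        (∀ x < (Order.succ μ).ord, g x < (Order.succ μ).ord) →
        ∃ β, l < β ∧ β < (Order.succ μ).ord ∧ (∀ ε < β, g ε < β) ∧ h β = τ := by
  classical
  have hκ := succ_regular hμ
  have hpos : 0 < (Order.succ μ).ord := hκ.ord_pos
  obtain ⟨e, he⟩ := exists_codes μ
  -- Ulam's matrix: some row `i` has unboundedly many `α` for which the set of `β` with `e β α = i`
  -- is stationary. Otherwise, for one large `α`, intersecting `μ` clubs leaves no possible value
  -- for `e β α`.
  obtain ⟨i, hi, hi'⟩ : ∃ i < μ.ord, ∀ ε < (Order.succ μ).ord, ∃ α < (Order.succ μ).ord, ε ≤ α ∧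
      ∀ g : Ordinal.{u} → Ordinal.{u}, (∀ x < (Order.succ μ).ord, g x < (Order.succ μ).ord) →
        ∃ β, α < β ∧ β < (Order.succ μ).ord ∧ (∀ ε < β, g ε < β) ∧ e β α = i := by
    by_contra! hcon
    choose! ε hε g hg hne using hcon
    obtain ⟨α, hα, hεα⟩ := exists_ord_succ_bound hμ (small_Iio_ord μ) hε
    have hG : ∀ x, ∃ y, x < (Order.succ μ).ord → y < (Order.succ μ).ord ∧
        ∀ i < μ.ord, g i α x < y := by
      intro x
      by_cases hx : x < (Order.succ μ).ord
      · obtain ⟨y, hy, hy'⟩ := exists_ord_succ_bound hμ (small_Iio_ord μ)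
          (f := fun i ↦ g i α x) fun i hi ↦ hg i hi α hα (hεα i hi).le x hx
        exact ⟨y, fun _ ↦ ⟨hy, hy'⟩⟩
      · exact ⟨0, fun h ↦ absurd h hx⟩
    choose G hG using hG
    obtain ⟨β, hβ, hαβ, -, hcl⟩ := exists_closure_point hμ (fun x hx ↦ (hG x hx).1) hα
    have hi : e β α < μ.ord := (he β hβ).2 hαβ
    exact hne _ hi α hα (hεα _ hi).le β hαβ hβ
      (fun ε' hε' ↦ ((hG ε' (hε'.trans hβ)).2 _ hi).trans (hcl ε' hε')) rfl
  let Z : Set Ordinal.{u} := {α | α < (Order.succ μ).ord ∧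
    ∀ g : Ordinal.{u} → Ordinal.{u}, (∀ x < (Order.succ μ).ord, g x < (Order.succ μ).ord) →
      ∃ β, α < β ∧ β < (Order.succ μ).ord ∧ (∀ ε < β, g ε < β) ∧ e β α = i}
  have hZ : ¬ SmallSet (Order.succ μ) Z := by
    refine not_small_of_unbounded hκ (fun α hα ↦ hα.1) fun ε hε ↦ ?_
    obtain ⟨α, hα, hεα, h⟩ := hi' ε hε
    exact ⟨α, ⟨hα, h⟩, hεα⟩
  have : Nonempty (Iio (Order.succ μ).ord) := ⟨⟨0, hpos⟩⟩
  obtain ⟨f, hf⟩ := exists_unbounded_fibers hκ.aleph0_le (τ := Iio (Order.succ μ).ord)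
    (by rw [Cardinal.mk_Iio_ordinal, card_ord]) hZ
  -- As `e β` is injective, `β` determines the `α` with `e β α = i`; these stationary sets are then
  -- grouped into `μ⁺` classes by `f`.
  refine ⟨fun β ↦ if h : ∃ α < β, e β α = i then f h.choose else 0, fun β ↦ ?_,
    fun τ hτ l hl g hg ↦ ?_⟩
  · dsimp only
    split_ifs
    · exact (f _).2
    · exact hpos
  · obtain ⟨α, hα, hlα, hfα⟩ := hf ⟨τ, hτ⟩ l hl
    obtain ⟨β, hαβ, hβ, hcl, heβ⟩ := hα.2 g hg
    refine ⟨β, hlα.trans_lt hαβ, hβ, hcl, ?_⟩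
    have hex : ∃ α < β, e β α = i := ⟨α, hαβ, heβ⟩
    have : hex.choose = α := (he β hβ).1 hex.choose_spec.1 hαβ (hex.choose_spec.2.trans heβ.symm)
    simp only [dif_pos hex, this, hfα]

theorem PR1_of_PL2 (hμ : μ.IsRegular)
    (hpl : PL2 (Order.succ μ) (Iio (Order.succ μ).ord) μ) :
    PR1 (Order.succ μ) (Order.succ μ) μ := by
  have hκ := succ_regular hμ
  obtain ⟨-, -, t, -, ht⟩ := hpl
  obtain ⟨h, hlt, hh⟩ := exists_stationary_partition hμ
  refine ⟨fun α β ↦ h (t α β).2, fun _ _ _ _ ↦ hlt _, fun σ hσ 𝒜 h𝒜 τ hτ ↦ ?_⟩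
  obtain ⟨D, hD, hD'⟩ := ht σ hσ 𝒜 h𝒜
  obtain ⟨g, hg, hgD⟩ := hD.2.exists_closure hμ
  obtain ⟨d, hd, hd0, -, hdcl⟩ := exists_closure_point hμ (fun x hx ↦ (hg x hx).2) hκ.ord_pos
  obtain ⟨β, hdβ, hβ, hβcl, hβτ⟩ := hh τ hτ d hd g fun x hx ↦ (hg x hx).2
  obtain ⟨a, ha, b, hb, hab, himg⟩ := hD' d ⟨hd, hgD d hd hd0 hdcl⟩ β
    ⟨hβ, hgD β hβ (hd0.trans hdβ) hβcl⟩ hdβ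
  refine ⟨a, ha, b, hb, hab, ?_⟩
  rw [← image_image2 t fun p ↦ h p.2, himg, image_singleton, hβτ]

/-! ### Peaks of lists -/

section Peak

variable {ι W : Type*} [LinearOrder W]

/-- The entry of `L` at index `i` is the last one of maximal weight. -/
def IsPeak (w : ι → W) (L : List ι) (i : ℕ) : Prop :=
  ∃ q, L[i]? = some q ∧ (∀ (j : ℕ) x, L[j]? = some x → w x ≤ w q) ∧
    ∀ (j : ℕ) x, i < j → L[j]? = some x → w x < w q

theorem IsPeak.unique {w : ι → W} {L : List ι} {i j : ℕ} (hi : IsPeak w L i)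
    (hj : IsPeak w L j) : i = j := by
  obtain ⟨q, hq, h1, h2⟩ := hi
  obtain ⟨q', hq', h1', h2'⟩ := hj
  rcases lt_trichotomy i j with h | h | h
  · exact absurd (h2 j q' h hq') (h1' i q hq).not_gt
  · exact h
  · exact absurd (h2' i q h hq) (h1 j q' hq').not_gt

theorem exists_isPeak (w : ι → W) {L : List ι} (hL : L ≠ []) : ∃ i, IsPeak w L i := by
  induction L with
  | nil => exact absurd rfl hL
  | cons a L ih =>
    rcases eq_or_ne L [] with rfl | hne
    · refine ⟨0, a, rfl, fun j x hj ↦ ?_, fun j x h0 hj ↦ ?_⟩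
      · rcases j with _ | j
        · obtain rfl : a = x := by simpa using hj
          exact le_rfl
        · simp at hj
      · rcases j with _ | j
        · exact absurd h0 (lt_irrefl _)
        · simp at hj
    · obtain ⟨i, q, hq, h1, h2⟩ := ih hne
      rcases le_or_gt (w a) (w q) with h | h
      · refine ⟨i + 1, q, by simpa using hq, fun j x hj ↦ ?_, fun j x hij hj ↦ ?_⟩
        · rcases j with _ | j
          · obtain rfl : a = x := by simpa using hj
            exact h
          · exact h1 j x (by simpa using hj)
        · rcases j with _ | j
          · exact absurd hij (Nat.not_lt_zero _)
          · exact h2 j x (Nat.lt_of_succ_lt_succ hij) (by simpa using hj)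
      · refine ⟨0, a, rfl, fun j x hj ↦ ?_, fun j x h0 hj ↦ ?_⟩
        · rcases j with _ | j
          · obtain rfl : a = x := by simpa using hj
            exact le_rfl
          · exact (h1 j x (by simpa using hj)).trans h.le
        · rcases j with _ | j
          · exact absurd h0 (lt_irrefl _)
          · exact (h1 j x (by simpa using hj)).trans_lt h

/-- The peak of a long walk is that of its middle segment when the weights before and after stay
below one reached there. -/
theorem IsPeak.append {w : ι → W} {P M R : List ι} {r : ℕ} {k : W} (hM : IsPeak w M r)
    (hk : ∃ x ∈ M, k < w x) (hP : ∀ x ∈ P, w x ≤ k) (hR : ∀ x ∈ R, w x ≤ k) :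
    IsPeak w (P ++ (M ++ R)) (P.length + r) := by
  obtain ⟨q, hq, h1, h2⟩ := hM
  have hkq : k < w q := by
    obtain ⟨x, hx, hkx⟩ := hk
    obtain ⟨j, hj⟩ := List.mem_iff_getElem?.1 hx
    exact hkx.trans_le (h1 j x hj)
  have hr : r < M.length := (List.getElem?_eq_some_iff.1 hq).1
  refine ⟨q, ?_, fun j x hj ↦ ?_, fun j x hij hj ↦ ?_⟩
  · rw [List.getElem?_append_right (Nat.le_add_right _ _), Nat.add_sub_cancel_left,
      List.getElem?_append_left hr, hq]
  · have hx := List.mem_of_getElem? hj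
    simp only [List.mem_append] at hx
    rcases hx with hx | hx | hx
    · exact (hP x hx).trans hkq.le
    · obtain ⟨j, hj⟩ := List.mem_iff_getElem?.1 hx
      exact h1 j x hj
    · exact (hR x hx).trans hkq.le
  · have hPj : P.length ≤ j := by omega
    rw [List.getElem?_append_right hPj] at hj
    rcases lt_or_ge (j - P.length) M.length with h | h
    · rw [List.getElem?_append_left h] at hj
      exact h2 _ x (by omega) hj
    · rw [List.getElem?_append_right h] at hj
      exact (hR x (List.mem_of_getElem? hj)).trans_lt hkq

end Peak

/-! ### Ladders inside given cofinal sets -/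

/-- The subset of `A` obtained by moving each rung of `E` up to the next element of `A`. -/
def thinLadder (A E : Set Ordinal.{u}) : Set Ordinal.{u} :=
  {m | ∃ c ∈ E, m = sInf {x | x ∈ A ∧ c ≤ x}}

/-- If a moved rung is still below `x`, its original is at most `l`, so it is at most the first
element of `A` from `l` on. Moving rungs thus creates no accumulation at `x`. -/
theorem isCofinalIn_thinLadder {ζ : Ordinal.{u}} {A E : Set Ordinal.{u}} (hA : IsCofinalIn ζ A)
    (hE : IsCofinalIn ζ E) :
    IsCofinalIn ζ (thinLadder A E) ∧ thinLadder A E ⊆ A ∧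
      ∀ x < ζ, BoundedBelow E x → BoundedBelow (thinLadder A E) x := by
  have h1 : ∀ c ∈ E, sInf {x | x ∈ A ∧ c ≤ x} ∈ A ∧ c ≤ sInf {x | x ∈ A ∧ c ≤ x} := by
    intro c hc
    obtain ⟨x, hx, hcx⟩ := hA.2 c (hE.1 hc)
    exact csInf_mem (s := {x | x ∈ A ∧ c ≤ x}) ⟨x, hx, hcx⟩
  have hsub : thinLadder A E ⊆ A := by
    rintro _ ⟨c, hc, rfl⟩
    exact (h1 c hc).1
  refine ⟨⟨hsub.trans hA.1, fun β hβ ↦ ?_⟩, hsub, fun x hx ⟨l, hl, hl'⟩ ↦ ?_⟩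
  · obtain ⟨c, hc, hβc⟩ := hE.2 β hβ
    exact ⟨_, ⟨c, hc, rfl⟩, hβc.trans (h1 c hc).2⟩
  · obtain ⟨m, hm, hlm⟩ := hA.2 l (hl.trans hx)
    have hmem := csInf_mem (s := {x | x ∈ A ∧ l ≤ x}) ⟨m, hm, hlm⟩
    have h2 : ∀ c ∈ E, sInf {x | x ∈ A ∧ c ≤ x} < x → c ≤ l := fun c hc hcx ↦
      hl' c hc ((h1 c hc).2.trans_lt hcx)
    by_cases h : sInf {x | x ∈ A ∧ l ≤ x} < x
    · refine ⟨_, h, ?_⟩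
      rintro _ ⟨c, hc, rfl⟩ hcx
      exact csInf_le' ⟨hmem.1, (h2 c hc hcx).trans hmem.2⟩
    · refine ⟨l, hl, ?_⟩
      rintro _ ⟨c, hc, rfl⟩ hcx
      by_contra hlt
      exact h ((csInf_le' ⟨(h1 c hc).1, (not_le.1 hlt).le⟩ : sInf {x | x ∈ A ∧ l ≤ x} ≤ _).trans_lt
        hcx)

/-! ### Weights of walks -/

/-- Injectivity of `e ζ` allows fewer than `μ` steps of weight at most `K` out of each point. Walks
are finite, so the points reached from `η` by such steps form a countable union of small sets. -/
theorem small_low_weights (hμ : μ.IsRegular) (hω : ℵ₀ < μ)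
    {C : Ordinal.{u} → Set Ordinal.{u}} {e : Ordinal.{u} → Ordinal.{u} → Ordinal.{u}}
    (hC : ∀ ζ < (Order.succ μ).ord, IsCofinalIn ζ (C ζ))
    (he : ∀ ζ < (Order.succ μ).ord, InjOn (e ζ) (Iio ζ) ∧ MapsTo (e ζ) (Iio ζ) (Iio μ.ord))
    {η K : Ordinal.{u}} (hη : η < (Order.succ μ).ord) (hK : K < μ.ord) :
    SmallSet μ {δ | δ < η ∧ ∀ q ∈ walk C δ η, e q.1 q.2 ≤ K} := by
  let R : ℕ → Set Ordinal.{u} := fun n ↦ Nat.rec {η} (fun _ R ↦ ⋃ ζ ∈ R, {c | c < ζ ∧ e ζ c ≤ K}) n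
  have hR : ∀ n, R n ⊆ Iic η ∧ SmallSet μ (R n) := by
    intro n
    induction n with
    | zero => exact ⟨fun x (hx : x = η) ↦ hx.le,
        SmallSet.of_finite hμ.aleph0_le (finite_singleton η)⟩
    | succ n ih =>
      refine ⟨?_, .biUnion hμ ih.2 fun ζ hζ ↦ ?_⟩
      · refine iUnion₂_subset fun ζ hζ x hx ↦ ?_
        exact hx.1.le.trans (ih.1 hζ)
      · refine (SmallSet.Iic hμ.aleph0_le hK).of_injOn (f := e ζ) ?_ fun x hx ↦ hx.2
        exact (he ζ (lt_of_le_of_lt (ih.1 hζ) hη)).1.mono fun x hx ↦ hx.1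
  refine (SmallSet.iUnion_countable hμ hω fun n ↦ (hR n).2).mono ?_
  have key : ∀ δ ζ n, ζ ∈ R n → δ ≤ ζ → (∀ q ∈ walk C δ ζ, e q.1 q.2 ≤ K) → δ ∈ ⋃ n, R n := by
    intro δ ζ
    induction ζ using WellFoundedLT.induction with
    | ind ζ ih =>
      intro n hζ hδ hq
      rcases hδ.eq_or_lt with rfl | hlt
      · exact mem_iUnion.2 ⟨n, hζ⟩
      · have hζη := hC ζ (lt_of_le_of_lt ((hR n).1 hζ) hη)
        obtain ⟨-, h2, h3⟩ := walkStep_spec hζη hlt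
        rw [walk_of_lt hζη hlt] at hq
        refine ih _ h3 (n + 1) ?_ h2 fun q hq' ↦ hq q (List.mem_cons_of_mem _ hq')
        exact mem_iUnion₂.2 ⟨ζ, hζ, h3, hq _ List.mem_cons_self⟩
  rintro δ ⟨hδ, hq⟩
  exact key δ η 0 rfl hδ.le hq

/-! ### Colouring by peaks -/

/-- The pair that the rungs at distance `N` around the peak of the walk from `β` to `α` code. -/
def PeakCode (o : Ordinal.{u}) (C : Ordinal.{u} → Set Ordinal.{u})
    (e : Ordinal.{u} → Ordinal.{u} → Ordinal.{u})
    (lab : Ordinal.{u} → (ℕ × ℕ → Ordinal.{u}) × Ordinal.{u})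
    (seq : Ordinal.{u} → ℕ × ℕ → Ordinal.{u}) (N : ℕ × ℕ) (α β : Ordinal.{u})
    (p : Ordinal.{u} × Ordinal.{u}) : Prop :=
  (p.1 ≤ α ∧ α < p.2 ∧ p.2 ≤ β) ∧ ∃ i η c δ v ξ,
    IsPeak (fun q : Ordinal.{u} × Ordinal.{u} ↦ e q.1 q.2) (walk C α β) i ∧
    (walk C α β)[i - N.1]? = some (η, c) ∧ (walk C α β)[i + N.2]? = some (δ, v) ∧
    η < o ∧ ξ < η ∧ e η ξ = (lab v).2 ∧ p = ((lab v).1 N, seq ξ N)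

/-- The peak and `N` determine `η` and `v`; then `ξ` is determined because `e η` is injective. -/
theorem PeakCode.unique {o : Ordinal.{u}} {C : Ordinal.{u} → Set Ordinal.{u}}
    {e : Ordinal.{u} → Ordinal.{u} → Ordinal.{u}} (he : ∀ ζ < o, InjOn (e ζ) (Iio ζ))
    {lab : Ordinal.{u} → (ℕ × ℕ → Ordinal.{u}) × Ordinal.{u}}
    {seq : Ordinal.{u} → ℕ × ℕ → Ordinal.{u}} {N : ℕ × ℕ} {α β : Ordinal.{u}}
    {p p' : Ordinal.{u} × Ordinal.{u}} (h : PeakCode o C e lab seq N α β p)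
    (h' : PeakCode o C e lab seq N α β p') : p = p' := by
  obtain ⟨-, i, η, c, δ, v, ξ, hi, h1, h2, hη, hξ, h3, rfl⟩ := h
  obtain ⟨-, i', η', c', δ', v', ξ', hi', h1', h2', hη', hξ', h3', rfl⟩ := h'
  obtain rfl := hi.unique hi'
  rw [h1] at h1'
  rw [h2] at h2'
  cases h1'
  cases h2'
  rw [he η hη hξ hξ' (h3.trans h3'.symm)]

open Classical in
/-- The colouring that decodes peaks. -/
noncomputable def peakColour (o : Ordinal.{u}) (C : Ordinal.{u} → Set Ordinal.{u})
    (e : Ordinal.{u} → Ordinal.{u} → Ordinal.{u})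
    (lab : Ordinal.{u} → (ℕ × ℕ → Ordinal.{u}) × Ordinal.{u})
    (seq : Ordinal.{u} → ℕ × ℕ → Ordinal.{u}) (N : ℕ × ℕ) (α β : Ordinal.{u}) :
    Ordinal.{u} × Ordinal.{u} :=
  if h : ∃ p, PeakCode o C e lab seq N α β p then h.choose else (α, β)

theorem peakColour_spec (o : Ordinal.{u}) (C : Ordinal.{u} → Set Ordinal.{u})
    (e : Ordinal.{u} → Ordinal.{u} → Ordinal.{u})
    (lab : Ordinal.{u} → (ℕ × ℕ → Ordinal.{u}) × Ordinal.{u})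
    (seq : Ordinal.{u} → ℕ × ℕ → Ordinal.{u}) (N : ℕ × ℕ) {α β : Ordinal.{u}} (h : α < β) :
    (peakColour o C e lab seq N α β).1 ≤ α ∧ α < (peakColour o C e lab seq N α β).2 ∧
      (peakColour o C e lab seq N α β).2 ≤ β := by
  rw [peakColour]
  split_ifs with hex
  · exact hex.choose_spec.1
  · exact ⟨le_rfl, h, le_rfl⟩

theorem peakColour_eq {o : Ordinal.{u}} {C : Ordinal.{u} → Set Ordinal.{u}}
    {e : Ordinal.{u} → Ordinal.{u} → Ordinal.{u}} (he : ∀ ζ < o, InjOn (e ζ) (Iio ζ))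
    {lab : Ordinal.{u} → (ℕ × ℕ → Ordinal.{u}) × Ordinal.{u}}
    {seq : Ordinal.{u} → ℕ × ℕ → Ordinal.{u}} {N : ℕ × ℕ} {α β : Ordinal.{u}}
    {p : Ordinal.{u} × Ordinal.{u}} (h : PeakCode o C e lab seq N α β p) :
    peakColour o C e lab seq N α β = p := by
  have hex : ∃ p, PeakCode o C e lab seq N α β p := ⟨p, h⟩
  rw [peakColour, dif_pos hex]
  exact hex.choose_spec.unique he h

/-! ### Guessing when the stick principle fails -/

/-- Shrink each `A δ` that is not small to order type `μ`. This sequence is not a stick sequence, so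
some `Y` includes none of the shrunken sets. -/
theorem exists_guessing_failure (hnst : ¬ Stick μ) (A : Ordinal.{u} → Set Ordinal.{u}) :
    ∃ Y : Set Ordinal.{u}, Y ⊆ Iio (Order.succ μ).ord ∧ ¬ SmallSet (Order.succ μ) Y ∧
      ∀ δ < (Order.succ μ).ord, A δ ⊆ Y → SmallSet μ (A δ) := by
  have h1 : ∀ δ, ∃ b, ¬ SmallSet μ (A δ) → b ⊆ A δ ∧ HasOtp b μ.ord := by
    intro δ
    by_cases h : SmallSet μ (A δ)
    · exact ⟨∅, fun h' ↦ absurd h h'⟩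
    · obtain ⟨b, hb⟩ := exists_subset_hasOtp h
      exact ⟨b, fun _ ↦ hb⟩
  choose X hX using h1
  rw [Stick] at hnst
  push Not at hnst
  obtain ⟨Y, hY, h⟩ := hnst X
  refine ⟨Y, hY.1, fun hs ↦ ?_, fun δ hδ hδY ↦ ?_⟩
  · have h1 := congrArg Ordinal.card hY.2
    rw [card_type, ← lift_card, card_ord] at h1
    rw [SmallSet, h1] at hs
    exact hs.false
  · by_contra hs
    exact h δ hδ ⟨(hX δ hs).1.trans hδY, (hX δ hs).2⟩

/-- Otherwise points closed under the bounds for bad partners form a club with no bad pair. The gain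
is that `α` can be fixed first and `β` postponed. -/
theorem exists_unbounded_bad (hμ : μ.IsRegular) {B : Ordinal.{u} → Ordinal.{u} → Prop}
    (h : ∀ D, IsClubIn (Order.succ μ).ord D → ∃ α ∈ D, ∃ β ∈ D, α < β ∧ B α β)
    {l : Ordinal.{u}} (hl : l < (Order.succ μ).ord) :
    ∃ α < (Order.succ μ).ord, l < α ∧ ∀ ε < (Order.succ μ).ord,
      ∃ β < (Order.succ μ).ord, ε ≤ β ∧ B α β := by
  by_contra! hcon
  have h1 : ∀ α, ∃ g, α < (Order.succ μ).ord → g < (Order.succ μ).ord ∧ (l < α →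
      ∀ β < (Order.succ μ).ord, g ≤ β → ¬ B α β) := by
    intro α
    by_cases hα : α < (Order.succ μ).ord ∧ l < α
    · obtain ⟨g, hg, h2⟩ := hcon α hα.1 hα.2
      exact ⟨g, fun _ ↦ ⟨hg, fun _ ↦ h2⟩⟩
    · exact ⟨l, fun h2 ↦ ⟨hl, fun h3 ↦ absurd ⟨h2, h3⟩ hα⟩⟩
  choose g hg using h1
  obtain ⟨α, ⟨hα, hlα, -⟩, β, ⟨hβ, -, hcl⟩, hαβ, hB⟩ :=
    h _ (isClubIn_closurePoints hμ (fun x hx ↦ (hg x hx).1) hl)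
  exact (hg α hα).2 hlα β hβ (hcl α hαβ).le hB

theorem exists_bound_countable (hμ : μ.IsRegular) {ι : Type} [Countable ι] {f : ι → Ordinal.{u}}
    (hf : ∀ i, f i < (Order.succ μ).ord) : ∃ b < (Order.succ μ).ord, ∀ i, f i < b := by
  have hκ := succ_regular hμ
  have hω : ℵ₀ < Order.succ μ := hμ.aleph0_le.trans_lt (Order.lt_succ μ)
  have h1 : SmallSet (Order.succ μ) (⋃ i, {f i}) :=
    .iUnion_countable hκ hω fun i ↦ .of_finite hκ.aleph0_le (finite_singleton _)
  obtain ⟨b, hb, h⟩ := h1.exists_lt_ord hκ (by simpa using hf)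
  exact ⟨b, hb, fun i ↦ h _ (mem_iUnion.2 ⟨i, rfl⟩)⟩

/-- Ladders that stay inside the sets `A δ`, for `δ` in `S`. -/
theorem exists_ladder_in (hμ : μ.IsRegular) {S : Set Ordinal.{u}} {A : Ordinal.{u} → Set Ordinal.{u}}
    (hS : ∀ α < (Order.succ μ).ord, ℵ₀ < α.cof → ¬ IsStationaryIn α S)
    (hA : ∀ δ ∈ S, Order.IsSuccLimit δ → IsCofinalIn δ (A δ)) :
    ∃ C : Ordinal.{u} → Set Ordinal.{u}, ∀ ζ < (Order.succ μ).ord, IsCofinalIn ζ (C ζ) ∧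
      (ζ ∈ S → Order.IsSuccLimit ζ → C ζ ⊆ A ζ) ∧
      ∀ x < ζ, x.cof = μ ∨ (x ∈ S ∧ Order.IsSuccLimit x) → BoundedBelow (C ζ) x := by
  classical
  obtain ⟨E, hE⟩ := exists_ladder hμ hS
  refine ⟨fun ζ ↦ if ζ ∈ S ∧ Order.IsSuccLimit ζ then thinLadder (A ζ) (E ζ) else E ζ,
    fun ζ hζ ↦ ?_⟩
  obtain ⟨h1, h2⟩ := hE ζ hζ
  by_cases h : ζ ∈ S ∧ Order.IsSuccLimit ζ
  · obtain ⟨h3, h4, h5⟩ := isCofinalIn_thinLadder (hA ζ h.1 h.2) h1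
    simp only [h, and_self, if_true]
    exact ⟨h3, fun _ _ ↦ h4, fun x hx hx' ↦ h5 x hx (h2 x hx hx')⟩
  · simp only [h, if_false]
    exact ⟨h1, fun h3 h4 ↦ absurd ⟨h3, h4⟩ h, h2⟩

section Guessing

variable {S Y : Set Ordinal.{u}} {A C a : Ordinal.{u} → Set Ordinal.{u}}
  {e : Ordinal.{u} → Ordinal.{u} → Ordinal.{u}} {ℓ : Ordinal.{u}}

/-- Small sets of points `δ` whose ladders consist of labels at which the walks to the sets `a d`
have low weight. -/
theorem exists_guessed_ladders (hμ : μ.IsRegular)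
    (hA : ∀ B, IsCofinalIn (Order.succ μ).ord B →
      IsStationaryIn (Order.succ μ).ord {δ | δ ∈ S ∧ A δ ⊆ B})
    (hYκ : Y ⊆ Iio (Order.succ μ).ord)
    (hYA : ∀ δ < (Order.succ μ).ord, A δ ⊆ Y → SmallSet μ (A δ))
    (hC : ∀ ζ < (Order.succ μ).ord, IsCofinalIn ζ (C ζ))
    (hCA : ∀ ζ < (Order.succ μ).ord, ζ ∈ S → Order.IsSuccLimit ζ → C ζ ⊆ A ζ)
    (he : ∀ ζ < (Order.succ μ).ord, MapsTo (e ζ) (Iio ζ) (Iio μ.ord))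
    (ha : ∀ ε < (Order.succ μ).ord, SmallSet μ (a ε) ∧ ∀ α ∈ a ε, α < (Order.succ μ).ord)
    (hℓ : ℓ < (Order.succ μ).ord) {Q : Ordinal.{u} → Prop}
    (hQ : ∀ ε < (Order.succ μ).ord, ∃ v ∈ Y, ε ≤ v ∧ Q v) :
    ∃ γ < (Order.succ μ).ord, ∃ K < μ.ord, ∃ Δ : Set Ordinal.{u}, ¬ SmallSet μ Δ ∧
      ∀ δ ∈ Δ, δ < γ ∧ δ ∈ S ∧ Order.IsSuccLimit δ ∧ ℓ < δ ∧ (∀ v ∈ C δ, e δ v ≤ K) ∧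
        ∀ v ∈ C δ, Q v ∧ ∃ d < (Order.succ μ).ord, ℓ ≤ d ∧ d < v ∧ (∀ α ∈ a d, α < v) ∧
          (∀ α ∈ a d, ∀ q ∈ walk C α v, e q.1 q.2 ≤ K) ∧ ∀ w ∈ C δ, w < v → w < d := by
  have hκ := succ_regular hμ
  have hnx : ∀ ε, ∃ v, ε < (Order.succ μ).ord → v ∈ Y ∧ ε < v ∧ Q v ∧ ∀ α ∈ a ε, α < v := by
    intro ε
    by_cases hε : ε < (Order.succ μ).ord
    · obtain ⟨b, hb, hab⟩ := (ha ε hε).1.succ.exists_lt_ord hκ (ha ε hε).2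
      obtain ⟨v, hv, hbv, hQv⟩ := hQ _ (max_lt (lt_ord_succ_add_one hμ hε) hb)
      exact ⟨v, fun _ ↦ ⟨hv, (Order.lt_succ ε).trans_le ((le_max_left _ _).trans hbv), hQv,
        fun α hα ↦ (hab α hα).trans_le ((le_max_right _ _).trans hbv)⟩⟩
    · exact ⟨0, fun h ↦ absurd h hε⟩
  choose nx hnx using hnx
  have hk : ∀ d, ∃ k, d < (Order.succ μ).ord → k < μ.ord ∧
      ∀ α ∈ a d, ∀ q ∈ walk C α (nx d), e q.1 q.2 < k := by
    intro d
    by_cases hd : d < (Order.succ μ).ord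
    · have h1 : SmallSet μ (⋃ α ∈ a d, {x | ∃ q ∈ walk C α (nx d), e q.1 q.2 = x}) := by
        refine .biUnion hμ (ha d hd).1 fun α _ ↦ .of_finite hμ.aleph0_le ?_
        refine ((walk C α (nx d)).map fun q ↦ e q.1 q.2).finite_toSet.subset ?_
        rintro _ ⟨q, hq, rfl⟩
        exact List.mem_map_of_mem (f := fun q : Ordinal.{u} × Ordinal.{u} ↦ e q.1 q.2) hq
      obtain ⟨k, hk, h⟩ := h1.exists_lt_ord hμ (by
        intro x hx
        simp only [mem_iUnion] at hx
        obtain ⟨α, hα, q, hq, rfl⟩ := hx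
        have hv := hYκ (hnx d hd).1
        have := mem_walk hC hv hq
        exact he q.1 (lt_of_le_of_lt this.2.1 hv) this.2.2.2.2)
      refine ⟨k, fun _ ↦ ⟨hk, fun α hα q hq ↦ h _ ?_⟩⟩
      simp only [mem_iUnion]
      exact ⟨α, hα, q, hq, rfl⟩
    · exact ⟨0, fun h ↦ absurd h hd⟩
  choose k hk using hk
  obtain ⟨L, hL, hL'⟩ := exists_fiber_unbounded hμ
    (P := fun d ↦ d < (Order.succ μ).ord ∧ ℓ ≤ d ∧ ∀ ε < d, nx ε < d) (f := k)
    (fun ε hε ↦ by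
      obtain ⟨d, hd, h1, -, h2⟩ := exists_closure_point hμ (fun x hx ↦ hYκ (hnx x hx).1)
        (max_lt hε hℓ)
      exact ⟨d, (le_max_left _ _).trans h1.le, hd, (le_max_right _ _).trans h1.le, h2⟩)
    fun d hd ↦ (hk d hd.1).1
  -- The labels in `B` share the weight bound `L`, and only closure points `d` enter, so that each
  -- `d` lies above all smaller rungs taken from `B`.
  let B : Set Ordinal.{u} := {v | ∃ d, (d < (Order.succ μ).ord ∧ ℓ ≤ d ∧ ∀ ε < d, nx ε < d) ∧
    k d = L ∧ nx d = v}
  have hBY : B ⊆ Y := by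
    rintro _ ⟨d, ⟨hd, -⟩, -, rfl⟩
    exact (hnx d hd).1
  have hB : IsCofinalIn (Order.succ μ).ord B := by
    refine ⟨hBY.trans hYκ, fun β hβ ↦ ?_⟩
    obtain ⟨d, hβd, hd, hkd⟩ := hL' β hβ
    exact ⟨_, ⟨d, hd, hkd, rfl⟩, hβd.trans (hnx d hd.1).2.1.le⟩
  have hr : ∀ δ, ∃ r, δ < (Order.succ μ).ord ∧ δ ∈ S ∧ Order.IsSuccLimit δ ∧ ℓ < δ ∧ A δ ⊆ B →
      r < μ.ord ∧ ∀ v ∈ C δ, e δ v < r := by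
    intro δ
    by_cases hδ : δ < (Order.succ μ).ord ∧ δ ∈ S ∧ Order.IsSuccLimit δ ∧ ℓ < δ ∧ A δ ⊆ B
    · obtain ⟨h1, h2, h3, h4, h5⟩ := hδ
      -- Here the failure of stick is used: the ladder has fewer than `μ` rungs, so its weights are
      -- bounded below `μ`.
      have h6 := (hYA δ h1 (h5.trans hBY)).mono (hCA δ h1 h2 h3)
      obtain ⟨r, hr, h⟩ := (h6.image (e δ)).exists_lt_ord hμ (by
        rintro _ ⟨v, hv, rfl⟩
        exact he δ h1 ((hC δ h1).1 hv))
      exact ⟨r, fun _ ↦ ⟨hr, fun v hv ↦ h _ ⟨v, hv, rfl⟩⟩⟩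
    · exact ⟨0, fun h ↦ absurd h hδ⟩
  choose r hr using hr
  obtain ⟨R, hR, hR'⟩ := exists_fiber_unbounded hμ
    (P := fun δ ↦ δ < (Order.succ μ).ord ∧ δ ∈ S ∧ Order.IsSuccLimit δ ∧ ℓ < δ ∧ A δ ⊆ B) (f := r)
    (fun ε hε ↦ by
      obtain ⟨δ, ⟨h1, h2⟩, h3, h4, h5⟩ := (hA B hB).exists_closure hμ
        (fun x hx ↦ lt_ord_succ_add_one hμ hx) (max_lt hε hℓ)
      refine ⟨δ, (le_max_left _ _).trans h4.le, h3, h1, ?_, (le_max_right _ _).trans_lt h4, h2⟩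
      rw [Order.isSuccLimit_iff, Order.isSuccPrelimit_iff_succ_lt]
      exact ⟨fun h ↦ not_lt_bot (h.eq_bot ▸ h4), fun b hb ↦ h5 b hb⟩)
    fun δ hδ ↦ (hr δ hδ).1
  let Δ₀ : Set Ordinal.{u} := {δ | (δ < (Order.succ μ).ord ∧ δ ∈ S ∧ Order.IsSuccLimit δ ∧ ℓ < δ ∧
    A δ ⊆ B) ∧ r δ = R}
  have hΔ₀ : ¬ SmallSet μ Δ₀ := by
    intro h
    refine not_small_of_unbounded hκ (fun δ hδ ↦ hδ.1.1) (fun ε hε ↦ ?_) h.succ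
    obtain ⟨δ, h1, h2⟩ := hR' ε hε
    exact ⟨δ, h2, h1⟩
  obtain ⟨Δ, hΔ, hΔotp⟩ := exists_subset_hasOtp hΔ₀
  obtain ⟨γ, hγ, hΔγ⟩ := (SmallSet.of_hasOtp hΔotp (ord_lt_ord_succ μ)).exists_lt_ord hκ
    fun δ hδ ↦ (hΔ hδ).1.1
  refine ⟨γ, hγ, max L R, max_lt hL hR, Δ, fun h ↦ ?_, fun δ hδ ↦ ?_⟩
  · have h1 := congrArg Ordinal.card hΔotp
    rw [card_type, ← lift_card, card_ord] at h1
    rw [SmallSet, h1] at h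
    exact h.false
  obtain ⟨⟨h1, h2, h3, h4, h5⟩, h6⟩ := hΔ hδ
  have hCB := (hCA δ h1 h2 h3).trans h5
  refine ⟨hΔγ δ hδ, h2, h3, h4, fun v hv ↦ ?_, fun v hv ↦ ?_⟩
  · exact (((hr δ ⟨h1, h2, h3, h4, h5⟩).2 v hv).le.trans h6.le).trans (le_max_right _ _)
  · obtain ⟨d, ⟨hd, hεd, hdcl⟩, hkd, hdv⟩ := hCB hv
    obtain ⟨-, h7, h8, h9⟩ := hnx d hd
    rw [hdv] at h7 h8 h9
    refine ⟨h8, d, hd, hεd, h7, h9, fun α hα q hq ↦ ?_, fun w hw hwv ↦ ?_⟩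
    · rw [← hdv] at hq
      exact (((hk d hd).2 α hα q hq).le.trans hkd.le).trans (le_max_left _ _)
    · obtain ⟨d', ⟨hd', -, hdcl'⟩, -, rfl⟩ := hCB hw
      rcases lt_trichotomy d d' with h | rfl | h
      · have h10 := (hdcl' d h).trans (hnx d' hd').2.1
        rw [hdv] at h10
        exact absurd h10 hwv.not_gt
      · exact absurd hdv hwv.ne
      · exact hdcl d' h

end Guessing

/-- For `μ = ℵ₀` the sets `A δ ⊆ Y` would be finite, yet one of them is cofinal in a limit ordinal.
-/
theorem aleph0_lt_of_small_cofinal (hμ : μ.IsRegular) {S : Set Ordinal.{u}}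
    {A : Ordinal.{u} → Set Ordinal.{u}} {Y : Set Ordinal.{u}}
    (hA : ∀ δ ∈ S, Order.IsSuccLimit δ → IsCofinalIn δ (A δ))
    (hst : IsStationaryIn (Order.succ μ).ord {δ | δ ∈ S ∧ A δ ⊆ Y})
    (hYA : ∀ δ < (Order.succ μ).ord, A δ ⊆ Y → SmallSet μ (A δ)) : ℵ₀ < μ := by
  obtain ⟨δ, ⟨h1, h2⟩, h3, h4, h5⟩ := hst.exists_closure hμ
    (fun x hx ↦ lt_ord_succ_add_one hμ hx) (succ_regular hμ).ord_pos
  have hlim : Order.IsSuccLimit δ := by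
    rw [Order.isSuccLimit_iff, Order.isSuccPrelimit_iff_succ_lt]
    exact ⟨fun h ↦ not_lt_bot (h.eq_bot ▸ h4), fun b hb ↦ h5 b hb⟩
  refine hμ.aleph0_le.lt_of_ne fun h0 ↦ ?_
  have hs := hYA δ h3 h2
  have hcof : ℵ₀ ≤ δ.cof := Ordinal.aleph0_le_cof_iff.2 (Ordinal.one_lt_cof_iff.2 hlim)
  obtain ⟨b, hb, h6⟩ := SmallSet.exists_lt (o := δ)
    (hs.trans_le (Cardinal.lift_le.2 (h0 ▸ hcof))) (hA δ h1 hlim).1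
  obtain ⟨α, hα, hbα⟩ := (hA δ h1 hlim).2 b hb
  exact (h6 α hα).not_ge hbα

theorem walk_prefix_lt (hμ : μ.IsRegular) {C : Ordinal.{u} → Set Ordinal.{u}}
    {e : Ordinal.{u} → Ordinal.{u} → Ordinal.{u}}
    (hC : ∀ ζ < (Order.succ μ).ord, IsCofinalIn ζ (C ζ))
    (he : ∀ ζ < (Order.succ μ).ord, MapsTo (e ζ) (Iio ζ) (Iio μ.ord)) {η : Ordinal.{u}}
    {b : Set Ordinal.{u}} (hb : SmallSet μ b) (hbo : ∀ β ∈ b, β < (Order.succ μ).ord) :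
    ∃ k < μ.ord, ∀ β ∈ b, ∀ q ∈ walk C η β, e q.1 q.2 ≤ k := by
  have h1 : SmallSet μ (⋃ β ∈ b, {x | ∃ q ∈ walk C η β, e q.1 q.2 = x}) := by
    refine .biUnion hμ hb fun β _ ↦ .of_finite hμ.aleph0_le ?_
    refine ((walk C η β).map fun q ↦ e q.1 q.2).finite_toSet.subset ?_
    rintro _ ⟨q, hq, rfl⟩
    exact List.mem_map_of_mem (f := fun q : Ordinal.{u} × Ordinal.{u} ↦ e q.1 q.2) hq
  obtain ⟨k, hk, h⟩ := h1.exists_lt_ord hμ (by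
    intro x hx
    simp only [mem_iUnion] at hx
    obtain ⟨β, hβ, q, hq, rfl⟩ := hx
    have := mem_walk hC (hbo β hβ) hq
    exact he q.1 (lt_of_le_of_lt this.2.1 (hbo β hβ)) this.2.2.2.2)
  refine ⟨k, hk, fun β hβ q hq ↦ (h _ ?_).le⟩
  simp only [mem_iUnion]
  exact ⟨β, hβ, q, hq, rfl⟩

theorem PL2_of_clubsuit_of_not_stick (hμ : μ.IsRegular)
    (hpow : (Order.succ μ) ^ ℵ₀ = Order.succ μ) {S : Set Ordinal.{u}}
    (hS : IsNonreflectingStationary (Order.succ μ) S) (hcl : Clubsuit (Order.succ μ) S)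
    (hnst : ¬ Stick μ) : PL2 (Order.succ μ) (Iio (Order.succ μ).ord) μ := by
  have hκ := succ_regular hμ
  have hpos : 0 < (Order.succ μ).ord := hκ.ord_pos
  obtain ⟨A, hA, hA'⟩ := hcl
  have hSr : ∀ α < (Order.succ μ).ord, ℵ₀ < α.cof → ¬ IsStationaryIn α S :=
    fun α hα hc h ↦ hS.2.2 ⟨α, hα, hc, h⟩
  obtain ⟨Y, hYκ, hYs, hYA⟩ := exists_guessing_failure hnst A
  have hYc : IsCofinalIn (Order.succ μ).ord Y := by
    refine ⟨hYκ, fun β hβ ↦ ?_⟩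
    by_contra! hcon
    exact hYs ((SmallSet.Iio_iff.2 hβ).mono hcon)
  have hω : ℵ₀ < μ := aleph0_lt_of_small_cofinal hμ hA (hA' Y hYc) hYA
  obtain ⟨e, he⟩ := exists_codes μ
  have heinj := fun ζ hζ ↦ (he ζ hζ).1
  have hemaps := fun ζ hζ ↦ (he ζ hζ).2
  obtain ⟨C, hC⟩ := exists_ladder_in hμ hSr hA
  have hCc : ∀ ζ < (Order.succ μ).ord, IsCofinalIn ζ (C ζ) := fun ζ hζ ↦ (hC ζ hζ).1
  let F := ℕ × ℕ → Iio (Order.succ μ).ord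
  have : Nonempty F := ⟨fun _ ↦ ⟨0, hpos⟩⟩
  have : Nonempty (Iio μ.ord) := ⟨⟨0, hμ.ord_pos⟩⟩
  have hF : #F ≤ Cardinal.lift.{u + 1} (Order.succ μ) := by
    rw [mk_arrow, Cardinal.mk_Iio_ordinal, card_ord, mk_eq_aleph0 (ℕ × ℕ)]
    simp only [Cardinal.lift_lift, lift_aleph0]
    rw [← lift_aleph0.{u + 1, u}, ← lift_power, hpow]
  have hκ' := aleph0_le_lift.{u, u + 1}.2 hκ.aleph0_le
  obtain ⟨seq, hseq⟩ := exists_unbounded_fibers hκ.aleph0_le hF (not_small_Iio_ord _)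
  obtain ⟨lab, hlab⟩ := exists_unbounded_fibers hκ.aleph0_le (τ := F × Iio μ.ord) (by
    rw [mk_prod, Cardinal.lift_id, Cardinal.lift_id, Cardinal.mk_Iio_ordinal, card_ord]
    exact mul_le_of_le hκ' hF (Cardinal.lift_le.2 (Order.le_succ μ))) hYs
  let lab' : Ordinal.{u} → (ℕ × ℕ → Ordinal.{u}) × Ordinal.{u} :=
    fun v ↦ (fun N ↦ (lab v).1 N, (lab v).2)
  let seq' : Ordinal.{u} → ℕ × ℕ → Ordinal.{u} := fun ξ N ↦ seq ξ N
  let t := peakColour (Order.succ μ).ord C e lab' seq'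
  by_contra hnpl
  have hfail : ∀ N, ∃ σ < μ.ord, ∃ 𝒜, IsDisjointFamily (Order.succ μ) σ 𝒜 ∧
      ∀ D, IsClubIn (Order.succ μ).ord D → ∃ α ∈ D, ∃ β ∈ D, α < β ∧
        ∀ a ∈ 𝒜, ∀ b ∈ 𝒜, SetBelow a b → image2 (t N) a b ≠ {(α, β)} := by
    intro N
    by_contra! hcon
    refine hnpl ⟨subset_rfl, ?_, t N, fun α β h _ ↦ peakColour_spec _ _ _ _ _ _ h,
      fun σ hσ 𝒜 h𝒜 ↦ ?_⟩
    · exact IsStationary.mono (isStationaryIn_cofSet hμ) fun x hx ↦ hx.1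
    · obtain ⟨D, hD, h⟩ := hcon σ hσ 𝒜 h𝒜
      exact ⟨D, hD, fun α hα β hβ hαβ ↦ h α hα.2 β hβ.2 hαβ⟩
  choose σ hσ 𝒜 h𝒜 hbad using hfail
  choose f hf using fun N ↦ (h𝒜 N).exists_selection
  -- The members chosen from all the counterexample families are handled together; their union is
  -- small because `μ` is regular and uncountable.
  let a : Ordinal.{u} → Set Ordinal.{u} := fun ε ↦ ⋃ N, f N ε
  have ha : ∀ ε < (Order.succ μ).ord, SmallSet μ (a ε) ∧
      ∀ α ∈ a ε, ε ≤ α ∧ α < (Order.succ μ).ord := by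
    intro ε hε
    refine ⟨.iUnion_countable hμ hω fun N ↦ (h𝒜 N).small (hσ N) (hf N ε hε).1, fun α hα ↦ ?_⟩
    obtain ⟨N, hN⟩ := mem_iUnion.1 hα
    exact (hf N ε hε).2 α hN
  obtain ⟨l, hl, hl'⟩ := exists_unbounded_walk_append hμ hCc
    (fun ζ hζ x hx hcof ↦ (hC ζ hζ).2.2 x hx (Or.inl hcof)) (b := a)
    (fun η hη ↦ (ha η hη).1) fun η hη ↦ (ha η hη).2
  choose α' hα' hlα' hα'bad using fun N ↦ exists_unbounded_bad hμ (hbad N) hl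
  obtain ⟨z, hz, hαz⟩ := exists_bound_countable hμ hα'
  -- The code `τ` of `ξ` at `η` is known only once `η` is chosen, so guessed ladders are prepared
  -- for every `τ`, with labels that already name all the `α' N`.
  have hguess := fun τ : Iio μ.ord ↦ exists_guessed_ladders hμ hA' hYκ hYA hCc
    (fun ζ hζ ↦ (hC ζ hζ).2.1) hemaps
    (fun ε hε ↦ ⟨(ha ε hε).1, fun α hα ↦ ((ha ε hε).2 α hα).2⟩) hz
    (Q := fun v ↦ lab v = (fun N ↦ ⟨α' N, hα' N⟩, τ)) fun ε hε ↦ hlab _ ε hε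
  choose γ hγ K hK Δ hΔ hΔ' using hguess
  obtain ⟨g, hg, hγg⟩ : ∃ g < (Order.succ μ).ord, ∀ τ, γ τ < g := by
    obtain ⟨g, hg, h⟩ := exists_ord_succ_bound hμ (s := (univ : Set (Iio μ.ord)))
      (by
        rw [SmallSet, mk_univ]
        exact small_Iio_ord μ) (f := γ) fun τ _ ↦ hγ τ
    exact ⟨g, hg, fun τ ↦ h τ (mem_univ τ)⟩
  -- Each `β' N` is taken at or above the bound `g` of all guessed `δ`, so that `α < δ < β' N`; it
  -- remains bad with the `α' N` fixed before.
  choose β' hβ' hgβ' hβ'bad using fun N ↦ hα'bad N g hg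
  obtain ⟨ξ, hξ, -, hseqξ⟩ := hseq (fun N ↦ ⟨β' N, hβ' N⟩) 0 hpos
  obtain ⟨z', hz', hβz'⟩ := exists_bound_countable hμ hβ'
  obtain ⟨η, hη, hεη, hηcof, hwalk⟩ := hl' (max g (max (Order.succ ξ) z'))
    (max_lt hg (max_lt (lt_ord_succ_add_one hμ hξ) hz'))
  obtain ⟨hgη, hεη⟩ := max_le_iff.1 hεη
  obtain ⟨hξη, hzη⟩ := max_le_iff.1 hεη
  replace hξη := (Order.lt_succ ξ).trans_le hξη
  obtain ⟨k, hk, hkη⟩ := walk_prefix_lt hμ hCc hemaps (η := η) (ha η hη).1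
    fun β hβ ↦ ((ha η hη).2 β hβ).2
  let τ : Iio μ.ord := ⟨e η ξ, hemaps η hη hξη⟩
  -- Fewer than `μ` points below `η` are reached from it with low weights, while `Δ τ` has at least
  -- `μ` elements.
  obtain ⟨δ, hδ, hδw⟩ : ∃ δ ∈ Δ τ, ∃ q ∈ walk C δ η, max k (K τ) < e q.1 q.2 := by
    by_contra! hcon
    refine hΔ τ ((small_low_weights hμ hω hCc he hη (max_lt hk (hK τ))).mono fun δ hδ ↦ ?_)
    exact ⟨((hΔ' τ δ hδ).1.trans (hγg τ)).trans_le hgη, hcon δ hδ⟩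
  obtain ⟨hδγ, hδS, hδlim, hzδ, hδK, hδC⟩ := hΔ' τ δ hδ
  have hδη : δ < η := (hδγ.trans (hγg τ)).trans_le hgη
  have hδκ := hδη.trans hη
  have hMne : walk C δ η ≠ [] := by
    rintro h
    obtain ⟨q, hq, -⟩ := hδw
    simp [h] at hq
  obtain ⟨r, hr⟩ := exists_isPeak (fun q : Ordinal.{u} × Ordinal.{u} ↦ e q.1 q.2) hMne
  have hrlen : r < (walk C δ η).length := by
    obtain ⟨q, hq, -⟩ := hr
    exact (List.getElem?_eq_some_iff.1 hq).1
  obtain ⟨l₂, hl₂, hl₂'⟩ := exists_walk_append hCc hη hδlim.bot_lt hδη.le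
    fun ζ hζ hδζ ↦ (hC ζ hζ).2.2 δ hδζ (Or.inr ⟨hδS, hδlim⟩)
  obtain ⟨w, hw, hlw⟩ := (hCc δ hδκ).2 (max l₂ z) (max_lt hl₂ hzδ)
  obtain ⟨hl₂w, hzw⟩ := max_le_iff.1 hlw
  have hwδ : w < δ := (hCc δ hδκ).1 hw
  -- The rung next after `w`: as `w < d` and `a d` lies in `[d, v)`, every walk from `δ` to a point
  -- of `a d` steps to `v`.
  obtain ⟨hv, hwv, hvδ⟩ := walkStep_spec (hCc δ hδκ) (hδlim.succ_lt hwδ)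
  set v := walkStep C (Order.succ w) δ with hvdef
  replace hwv := (Order.lt_succ w).trans_le hwv
  obtain ⟨hlabv, d, hd, -, hdv, hav, hadK, hwd⟩ := hδC v hv
  replace hwd := hwd w hw hwv
  -- The distances from the peak back to the step at `η` and forward to the step from `δ` to `v`.
  -- The failure of this particular `N` is the one contradicted.
  let N : ℕ × ℕ := (r, (walk C δ η).length - r)
  have hlt : ∀ α ∈ f N d, α < δ := fun α hα ↦
    (hav α (mem_iUnion.2 ⟨N, hα⟩)).trans hvδ
  refine hβ'bad N (f N d) (hf N d hd).1 (f N η) (hf N η hη).1 (fun α hα β hβ ↦ ?_) ?_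
  · exact ((hlt α hα).trans hδη).trans_le ((hf N η hη).2 β hβ).1
  refine image2_eq_singleton ((h𝒜 N).nonempty hκ.aleph0_le (hf N d hd).1)
    ((h𝒜 N).nonempty hκ.aleph0_le (hf N η hη).1) fun α hα β hβ ↦ ?_
  have hαa : α ∈ a d := mem_iUnion.2 ⟨N, hα⟩
  have hβa : β ∈ a η := mem_iUnion.2 ⟨N, hβ⟩
  have hwα : w < α := hwd.trans_le ((hf N d hd).2 α hα).1
  have hαv := hav α hαa
  have hαδ := hlt α hα
  have hlα : l < α := (hlα' N).trans ((hαz N).trans (hzw.trans_lt hwα))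
  have hw1 : walk C α β = walk C η β ++ (walk C δ η ++ (δ, v) :: walk C α v) := by
    rw [hwalk β hβa α hlα (hαδ.trans hδη).le, hl₂' α (hl₂w.trans_lt hwα) hαδ.le,
      walk_eq_append_of_mem hCc hδκ hv hαv.le fun c hc hαc ↦
        walkStep_le hc (Order.succ_le_of_lt (hwα.trans_le hαc))]
  have hpeak : IsPeak (fun q : Ordinal.{u} × Ordinal.{u} ↦ e q.1 q.2) (walk C α β)
      ((walk C η β).length + r) := by
    rw [hw1]
    refine hr.append hδw (fun q hq ↦ (hkη β hβa q hq).trans (le_max_left _ _)) fun q hq ↦ ?_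
    rcases List.mem_cons.1 hq with rfl | hq
    · exact (hδK v hv).trans (le_max_right _ _)
    · exact (hadK α hαa q hq).trans (le_max_right _ _)
  have hlab1 : (lab' v).1 N = α' N := by simp [lab', hlabv]
  have hlab2 : (lab' v).2 = e η ξ := by simp [lab', hlabv, τ]
  have hseq1 : seq' ξ N = β' N := by simp [seq', hseqξ]
  refine peakColour_eq heinj ⟨⟨?_, ?_, ?_⟩, _, η, walkStep C δ η, δ, v, ξ, hpeak, ?_, ?_, hη, hξη,
    hlab2.symm, by rw [hlab1, hseq1]⟩
  · exact ((hαz N).trans (hzw.trans_lt hwα)).le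
  · exact (hαδ.trans (hδγ.trans (hγg τ))).trans_le (hgβ' N)
  · exact ((hβz' N).le.trans hzη).trans ((hf N η hη).2 β hβ).1
  · rw [hw1, Nat.add_sub_cancel, List.getElem?_append_right le_rfl, Nat.sub_self,
      walk_of_lt (hCc η hη) hδη]
    rfl
  · have h1 : (walk C η β).length + r + N.2 = (walk C η β).length + (walk C δ η).length := by
      simp only [N]
      omega
    rw [hw1, h1, List.getElem?_append_right (Nat.le_add_right _ _), Nat.add_sub_cancel_left,
      List.getElem?_append_right le_rfl, Nat.sub_self]
    rfl

/-! ### Assembling the cases -/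

theorem PL2_of_clubsuit (hμ : μ.IsRegular) (hpow : (Order.succ μ) ^ ℵ₀ = Order.succ μ)
    (h : ∃ S, IsNonreflectingStationary (Order.succ μ) S ∧ Clubsuit (Order.succ μ) S) :
    PL2 (Order.succ μ) (Iio (Order.succ μ).ord) μ := by
  obtain ⟨S, hS, hcl⟩ := h
  by_cases hst : Stick μ
  · exact PL2_of_stick hμ hst
  · exact PL2_of_clubsuit_of_not_stick hμ hpow hS hcl hst

theorem theoremA (μ : Cardinal.{u}) (hμ : μ.IsRegular) :
    ((Stick μ ∨
        ((Order.succ μ) ^ ℵ₀ = Order.succ μ ∧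
          ∃ S, IsNonreflectingStationary (Order.succ μ) S ∧ Clubsuit (Order.succ μ) S)) →
      PL2 (Order.succ μ) (cofSet (Order.succ μ) μ) μ) ∧
    (((Order.succ μ) ^ ℵ₀ = Order.succ μ ∧
        ∃ S, IsNonreflectingStationary (Order.succ μ) S ∧ Clubsuit (Order.succ μ) S) →
      PL2 (Order.succ μ) (Iio (Order.succ μ).ord) μ) ∧
    (2 ^ μ = Order.succ μ → PR1 (Order.succ μ) (Order.succ μ) μ) := by
  refine ⟨fun h ↦ ?_, fun h ↦ PL2_of_clubsuit hμ h.1 h.2,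
    fun h ↦ PR1_of_PL2 hμ (PL2_of_stick hμ (stick_of_two_power hμ h))⟩
  have hpl : PL2 (Order.succ μ) (Iio (Order.succ μ).ord) μ := by
    rcases h with h | h
    · exact PL2_of_stick hμ h
    · exact PL2_of_clubsuit hμ h.1 h.2
  exact hpl.mono (fun x hx ↦ hx.1) (isStationaryIn_cofSet hμ)
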